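/- **Theorem 2.** For $1\le s\le\infty$ let $L_s$ be the space of real $2\pi$-periodic functions with norm $\|f\|_s=\big(\int_{-\pi}^{\pi}|f(t)|^s\,dt\big)^{1/s}$ for $s<\infty$ and $\|f\|_\infty=\operatorname{ess\,sup}|f|$ (and $1/s:=0$ for $s=\infty$). Let $0<q<1$ and let $\psi\in\mathcal D_q$, i.e. $\psi(k)>0$ for $k\ge1$ and $\lim_{k\to\infty}\psi(k+1)/\psi(k)=q$. Let $\beta\in\mathbb R$. A function $f\in L_1$ with Fourier coefficients $a_k,b_k$ belongs to $L^\psi_\beta L_1$ if the series $$\sum_{k\ge1}\frac1{\psi(k)}\Big(a_k\cos\big(kx+\tfrac{\beta\pi}2\big)+b_k\sin\big(kx+\tfrac{\beta\pi}2\big)\Big)$$ is the Fourier series of some function of $L_1$, which is denoted by $f^\psi_\beta$. For $n,p\in\mathbb N$, $1\le p\le n$, put $V_{n,p}(f)=\frac1p\sum_{k=n-p}^{n-1}S_k(f)$, where $S_k(f)$ is the partial Fourier sum of order $k$; let $E_m(\varphi)_{L_1}$ be the infimum of $\|\varphi-t\|_1$ over trigonometric polynomials $t$ of order at most $m-1$;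 and let $$K_{q,p}(s)=2^{-1/s}\Big\|\frac{\sqrt{1-2q^p\cos pt+q^{2p}}}{1-2q\cos t+q^2}\Big\|_s,\qquad \varepsilon_m=\sup_{k\ge m}\Big|\frac{\psi(k+1)}{\psi(k)}-q\Big|,$$ $\sigma(s,p)=1$ if $s=1$, $p=1$; $\sigma(s,p)=2$ if $1<s\le\infty$, $p=1$; $\sigma(s,p)=3$ if $p\ge2$. Consider the inequality, with a constant $A$ in place of $O(1)$, $$\|f-V_{n,p}(f)\|_s\le\frac{\psi(n-p+1)}p\bigg(\frac{\|\cos t\|_s}{\pi^{1+1/s}}K_{q,p}(s)+A\Big(\frac q{(n-p+1)(1-q)^{\sigma(s,p)}}+\frac{\varepsilon_{n-p+1}}{(1-q)^2}\min\Big\{p,\frac1{1-q}\Big\}\Big)\bigg)E_{n-p+1}(f^\psi_\beta)_{L_1}.\qquad(*)$$ There is an absolute constant $C>0$ such that for all $q\in(0,1)$ and $\psi\in\mathcal D_q$: 1. there is $N=N(q,\psi)$ such that $(*)$ holds with $A=C$ for all $\beta\in\mathbb R$, all $n,p\in\mathbb N$ with $p\le n$ and $n-p\ge N$, all $1\le s\le\infty$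 and all $f\in L^\psi_\beta L_1$; 2. more precisely, $(*)$ holds with $A=C$ for all $\beta\in\mathbb R$, all $n,p\in\mathbb N$ with $p\le n$ and $\varepsilon_{n-p+1}\le\frac{1-q}2$, all $1\le s\le\infty$ and all $f\in L^\psi_\beta L_1$; 3. there is $C'=C'(q,\psi)>0$ such that $(*)$ holds with $A=C'$ for all $\beta\in\mathbb R$, all $n,p\in\mathbb N$ with $p\le n$, all $1\le s\le\infty$ and all $f\in L^\psi_\beta L_1$. -/

import Mathlib

open Real Set Filter Topology MeasureTheory
open scoped ENNReal

noncomputable section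

namespace ValleePoussin

/-- Lebesgue measure on one period. -/
def periodMeasure : Measure ℝ := volume.restrict (Ioc (-π) π)

/-- The non-normalized norm of `L_s` of the period, with values in `[0, ∞]`. -/
def normL (s : ℝ≥0∞) (f : ℝ → ℝ) : ℝ≥0∞ := eLpNorm f s periodMeasure

/-- The space `L_1` of real `2π`-periodic functions that are summable on the period. -/
def PeriodicL1 (f : ℝ → ℝ) : Prop :=
  Function.Periodic f (2 * π) ∧ Integrable f periodMeasure

/-- Fourier cosine coefficients `a_k(f)`. -/
def coefA (f : ℝ → ℝ) (k : ℕ) : ℝ := (1 / π) * ∫ t in (-π)..π, f t * cos (k * t)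

/-- Fourier sine coefficients `b_k(f)`. -/
def coefB (f : ℝ → ℝ) (k : ℕ) : ℝ := (1 / π) * ∫ t in (-π)..π, f t * sin (k * t)

/-- Partial Fourier sum `S_k(f; x)` of order `k`. -/
def fourierSum (k : ℕ) (f : ℝ → ℝ) (x : ℝ) : ℝ :=
  coefA f 0 / 2 + ∑ j ∈ Finset.Icc 1 k, (coefA f j * cos (j * x) + coefB f j * sin (j * x))

/-- De la Vallée Poussin sum `V_{n,p}(f; x)`, for `1 ≤ p ≤ n`. -/
def valleePoussinSum (n p : ℕ) (f : ℝ → ℝ) (x : ℝ) : ℝ :=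
  (1 / (p : ℝ)) * ∑ k ∈ Finset.Ico (n - p) n, fourierSum k f x

/-- `φ` is a `(ψ, β)`-derivative of `f`: it lies in `L_1` and its Fourier series is, term by term,
`∑_{k ≥ 1} (1 / ψ(k)) (a_k cos(kx + βπ/2) + b_k sin(kx + βπ/2))`, where `a_k`, `b_k` are the
Fourier coefficients of `f`. -/
def IsPsiBetaDerivative (ψ : ℕ → ℝ) (β : ℝ) (f φ : ℝ → ℝ) : Prop :=
  PeriodicL1 φ ∧ coefA φ 0 = 0 ∧
    ∀ k : ℕ, 1 ≤ k → ∀ x : ℝ,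
      coefA φ k * cos (k * x) + coefB φ k * sin (k * x) =
        (1 / ψ k) * (coefA f k * cos (k * x + β * π / 2) + coefB f k * sin (k * x + β * π / 2))

/-- The condition `D_q` for a positive sequence `ψ(1), ψ(2), …` (the value `ψ 0` plays no role). -/
def ClassD (q : ℝ) (ψ : ℕ → ℝ) : Prop :=
  (∀ k : ℕ, 1 ≤ k → 0 < ψ k) ∧ Tendsto (fun k : ℕ => ψ (k + 1) / ψ k) atTop (𝓝 q)

/-- Trigonometric polynomials of order at most `m - 1` (for `m ≥ 1`). -/
def trigPoly (m : ℕ) : Set (ℝ → ℝ) :=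
  {t | ∃ a b : ℕ → ℝ, ∀ x, t x = ∑ k ∈ Finset.range m, (a k * cos (k * x) + b k * sin (k * x))}

/-- Best approximation `E_m(φ)` in `L_s` by trigonometric polynomials of order at most `m - 1`. -/
def bestApprox (m : ℕ) (s : ℝ≥0∞) (φ : ℝ → ℝ) : ℝ≥0∞ :=
  ⨅ t ∈ trigPoly m, normL s (fun x => φ x - t x)

/-- `ε_m(ψ) = sup_{k ≥ m} |ψ(k+1)/ψ(k) - q|`. -/
def eps (q : ℝ) (ψ : ℕ → ℝ) (m : ℕ) : ℝ :=
  ⨆ j : ℕ, |ψ (m + j + 1) / ψ (m + j) - q|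

/-- The constant `K_{q,p}(u)`; for `u = ∞` the exponent `1/u` is `0`. -/
def constK (q : ℝ) (p : ℕ) (u : ℝ≥0∞) : ℝ :=
  (2 : ℝ) ^ (-(u⁻¹).toReal) *
    (normL u (fun t =>
      √(1 - 2 * q ^ p * cos (p * t) + q ^ (2 * p)) / (1 - 2 * q * cos t + q ^ 2))).toReal

open Classical in
/-- The exponent `σ(u, p)`. -/
def sigma (u : ℝ≥0∞) (p : ℕ) : ℕ :=
  if p = 1 then (if u = 1 then 1 else 2) else 3

/-- The main term `‖cos t‖_s π^{-1-1/s} K_{q,p}(s)`. -/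
def mainTerm (q : ℝ) (p : ℕ) (s : ℝ≥0∞) : ℝ :=
  (normL s cos).toReal / π ^ (1 + (s⁻¹).toReal) * constK q p s

/-- The expression under the sign `O(1)`. -/
def remainder (q : ℝ) (ψ : ℕ → ℝ) (n p : ℕ) (s : ℝ≥0∞) : ℝ :=
  q / (((n - p + 1 : ℕ) : ℝ) * (1 - q) ^ sigma s p) +
    eps q ψ (n - p + 1) / (1 - q) ^ 2 * min (p : ℝ) (1 / (1 - q))

/-- The Lebesgue-type inequality, with the quantity `O(1)` bounded by `C`, for given `n`, `p`, `β`,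
all `s ∈ [1, ∞]` and all `f ∈ L^ψ_β L_1` with `(ψ, β)`-derivative `φ`. Both sides lie in `[0, ∞]`;
finiteness of the left side is part of the claim. -/
def LebesgueInequality (C q : ℝ) (ψ : ℕ → ℝ) (β : ℝ) (n p : ℕ) : Prop :=
  ∀ s : ℝ≥0∞, 1 ≤ s → ∀ f φ : ℝ → ℝ, PeriodicL1 f → IsPsiBetaDerivative ψ β f φ →
    normL s (fun x => f x - valleePoussinSum n p f x) ≤
      ENNReal.ofReal (ψ (n - p + 1) / p * (mainTerm q p s + C * remainder q ψ n p s)) *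
        bestApprox (n - p + 1) 1 φ

end ValleePoussin

end

namespace ValleePoussin

/-! Put M = n - p + 1 and let φ be the (ψ, β)-derivative of f. The deviation f - V_{n,p}(f) is the
mean of p Fourier tails, so its harmonic of order M + i carries the weight min(i + 1, p) / p. In
terms of φ it is 1/(πp) times the convolution of φ with `kernel`. All frequencies of the kernel are
at least M, so any trigonometric polynomial T of order below M may be subtracted from φ. Young's
inequality and the infimum over T then reduce the theorem to an upper bound for the L_s norm of the
kernel (`ClassD.lebesgueInequality_of_kernel`).

Since ψ(M+i)/ψ(M) is close to q^i, the kernel is close to ψ(M) Re(e^{i(Mu-γ)} G(u)), where γ = βπ/2,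
G = ∑ min(i+1, p) w^i = (1 - w^p)/(1 - w)^2 and w = q e^{iu}; |G| is exactly the function inside
K_{q,p}. The replacement costs the ε-term of the remainder (`ClassD.abs_kernel_sub_le`).

For finite s the leading part is treated by averaging over the phase (`normL_modulated_le`). If the
phase is shifted by θ, the mean over θ of the s-th power of the norm is exactly ‖G‖_s^s ‖cos‖_s^s /
(2π), so some θ does no worse. Translating u by θ/M, at most π/M in size, produces this phase at the
price of the L_s modulus of continuity of G, which is the term q / (M (1-q)^σ)
(`normL_modulus_sub_le`).

All constants are absolute once ε_M ≤ (1-q)/2. Only finitely many M violate this, and for them the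
remainder is at least 1/2, so a crude bound for the kernel is absorbed into C'. -/

instance : IsFiniteMeasure periodMeasure := by
  unfold periodMeasure; infer_instance

/-! ### Norms over a period and Young's inequality -/

lemma periodMeasure_univ : periodMeasure univ = ENNReal.ofReal (2 * π) := by
  rw [periodMeasure, Measure.restrict_apply_univ, Real.volume_Ioc]
  congr 1; ring

/-- Translation invariance of the integral of a periodic function over the period. -/
lemma lintegral_period_add {F : ℝ → ℝ≥0∞} (hF : Function.Periodic F (2 * π)) (v : ℝ) :
    ∫⁻ u, F (u + v) ∂periodMeasure = ∫⁻ u, F u ∂periodMeasure := by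
  have hT : (0 : ℝ) < 2 * π := by positivity
  have : VAddInvariantMeasure (AddSubgroup.zmultiples (2 * π)) ℝ volume :=
    ⟨fun c s _ => measure_preimage_add _ _ _⟩
  have h1 : ∫⁻ u in Ioc (-π + v) (-π + v + 2 * π), F u = ∫⁻ u in Ioc (-π) (-π + 2 * π), F u := by
    apply IsAddFundamentalDomain.setLIntegral_eq (G := AddSubgroup.zmultiples (2 * π))
    exacts [isAddFundamentalDomain_Ioc hT _, isAddFundamentalDomain_Ioc hT _, hF.map_vadd_zmultiples]
  have h2 : -π + 2 * π = π := by ring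
  rw [h2] at h1
  rw [periodMeasure, ← h1]
  have h3 := (measurePreserving_add_right (volume : Measure ℝ) v).setLIntegral_comp_preimage_emb
    (measurableEmbedding_addRight v) F (Ioc (-π + v) (-π + v + 2 * π))
  rw [← h3]
  congr 2
  ext u
  simp only [mem_Ioc, mem_preimage]
  constructor <;> rintro ⟨h, h'⟩ <;> constructor <;> linarith

lemma normL_eq_lintegral {s : ℝ≥0∞} (hs : 1 ≤ s) (hs' : s ≠ ⊤) (f : ℝ → ℝ) :
    normL s f = (∫⁻ u, ‖f u‖ₑ ^ s.toReal ∂periodMeasure) ^ (1 / s.toReal) :=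
  eLpNorm_eq_lintegral_rpow_enorm_toReal (by positivity) hs'

lemma one_le_toReal {s : ℝ≥0∞} (hs : 1 ≤ s) (hs' : s ≠ ⊤) : 1 ≤ s.toReal := by
  rw [← ENNReal.toReal_one]
  exact ENNReal.toReal_mono hs' hs

lemma normL_comp_add {s : ℝ≥0∞} (hs : 1 ≤ s) (hs' : s ≠ ⊤) {f : ℝ → ℝ}
    (hf : Function.Periodic f (2 * π)) (v : ℝ) :
    normL s (fun u => f (u + v)) = normL s f := by
  rw [normL_eq_lintegral hs hs', normL_eq_lintegral hs hs']
  congr 1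
  exact lintegral_period_add (F := fun u => ‖f u‖ₑ ^ s.toReal)
    (fun x => by simp only [hf x]) v

/-- A uniform bound gives a bound of every norm. -/
lemma normL_le_of_bound {s : ℝ≥0∞} (hs : 1 ≤ s) {f : ℝ → ℝ} {c : ℝ} (hf : ∀ u, |f u| ≤ c) :
    normL s f ≤ ENNReal.ofReal (2 * π * c) := by
  have hc : 0 ≤ c := (abs_nonneg _).trans (hf 0)
  refine (eLpNorm_le_of_ae_bound (C := c) (ae_of_all _ fun u => by simpa using hf u)).trans ?_
  rw [periodMeasure_univ, ENNReal.ofReal_mul (by positivity : (0 : ℝ) ≤ 2 * π)]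
  gcongr
  have h1 : (1 : ℝ≥0∞) ≤ ENNReal.ofReal (2 * π) := by
    rw [ENNReal.one_le_ofReal]; linarith [Real.pi_gt_three]
  conv_rhs => rw [← ENNReal.rpow_one (ENNReal.ofReal (2 * π))]
  apply ENNReal.rpow_le_rpow_of_exponent_le h1
  rcases eq_or_ne s ⊤ with rfl | hs'
  · simp
  · exact inv_le_one_of_one_le₀ (one_le_toReal hs hs')

lemma normL_ne_top_of_continuous {s : ℝ≥0∞} (hs : 1 ≤ s) {f : ℝ → ℝ} (hc : Continuous f)
    (hf : Function.Periodic f (2 * π)) : normL s f ≠ ⊤ := by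
  obtain ⟨c, hc'⟩ := (isCompact_Icc (a := -π) (b := -π + 2 * π)).exists_bound_of_continuousOn
    hc.continuousOn
  refine ne_top_of_le_ne_top ENNReal.ofReal_ne_top (normL_le_of_bound hs (c := c) fun u => ?_)
  obtain ⟨y, hy, hy'⟩ := hf.exists_mem_Ioc (by positivity : (0 : ℝ) < 2 * π) u (-π)
  rw [hy']
  exact hc' y (Ioc_subset_Icc_self hy)

lemma normL_mono {s : ℝ≥0∞} {f g : ℝ → ℝ} (h : ∀ u, |f u| ≤ |g u|) : normL s f ≤ normL s g :=
  eLpNorm_mono (fun u => by simpa using h u)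

lemma normL_add_le {s : ℝ≥0∞} (hs : 1 ≤ s) {f g : ℝ → ℝ} (hf : Continuous f)
    (hg : Continuous g) : normL s (fun u => f u + g u) ≤ normL s f + normL s g :=
  eLpNorm_add_le hf.aestronglyMeasurable hg.aestronglyMeasurable hs

/-- Continuity upgrades the almost everywhere bound to a pointwise one, and periodicity carries it
off the base period. This is what the case s = ∞ of Young's inequality uses. -/
lemma enorm_le_normL_top {f : ℝ → ℝ} (hc : Continuous f) (hf : Function.Periodic f (2 * π))
    (u : ℝ) : ‖f u‖ₑ ≤ normL ⊤ f := by
  have h1 : ∀ᵐ x ∂periodMeasure, ‖f x‖ₑ ≤ normL ⊤ f := by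
    rw [normL, eLpNorm_exponent_top]; exact ae_le_eLpNormEssSup
  have h2 : (fun x => max ‖f x‖ₑ (normL ⊤ f)) =ᵐ[periodMeasure] fun _ => normL ⊤ f := by
    filter_upwards [h1] with x hx using max_eq_right hx
  have h3 := Measure.eqOn_Ioc_of_ae_eq (μ := volume) h2
    ((hc.enorm.max continuous_const).continuousOn) continuousOn_const
  obtain ⟨y, hy, hy'⟩ := hf.exists_mem_Ioc (by positivity : (0 : ℝ) < 2 * π) u (-π)
  rw [show -π + 2 * π = π by ring] at hy
  rw [hy']
  have := h3 hy
  exact max_eq_right_iff.1 this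

/-- Young's inequality for the convolution over the period. -/
lemma normL_convolution_le {s : ℝ≥0∞} (hs : 1 ≤ s) {φ K : ℝ → ℝ} (hφ : Integrable φ periodMeasure)
    (hK : Continuous K) (hKp : Function.Periodic K (2 * π)) :
    normL s (fun x => ∫ t, φ t * K (x - t) ∂periodMeasure) ≤ normL 1 φ * normL s K := by
  have hb : ∀ x, ‖∫ t, φ t * K (x - t) ∂periodMeasure‖ₑ ≤
      ∫⁻ t, ‖φ t‖ₑ * ‖K (x - t)‖ₑ ∂periodMeasure := fun x =>
    (enorm_integral_le_lintegral_enorm _).trans_eq (by simp [enorm_mul])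
  have hφ1 : normL 1 φ = ∫⁻ t, ‖φ t‖ₑ ∂periodMeasure := eLpNorm_one_eq_lintegral_enorm
  have hφm : AEMeasurable (fun t => ‖φ t‖ₑ) periodMeasure := hφ.1.enorm
  rcases eq_or_ne s ⊤ with rfl | hs'
  · have : ∀ x, ‖∫ t, φ t * K (x - t) ∂periodMeasure‖ₑ ≤ normL 1 φ * normL ⊤ K := by
      intro x
      refine (hb x).trans ?_
      rw [hφ1, ← lintegral_mul_const'' _ hφm]
      exact lintegral_mono fun t => by gcongr; exact enorm_le_normL_top hK hKp _
    rw [normL, eLpNorm_exponent_top]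
    exact eLpNormEssSup_le_of_ae_enorm_bound (ae_of_all _ this)
  · have hS := one_le_toReal hs hs'
    set S := s.toReal with hSdef
    have hS0 : 0 < S := by linarith
    have hA : normL 1 φ ≠ ⊤ := (memLp_one_iff_integrable.2 hφ).2.ne
    set A := normL 1 φ with hAdef
    have hJ : ∀ x, ‖∫ t, φ t * K (x - t) ∂periodMeasure‖ₑ ^ S ≤
        A ^ (S - 1) * ∫⁻ t, ‖φ t‖ₑ * ‖K (x - t)‖ₑ ^ S ∂periodMeasure := by
      intro x
      -- Comparing the L_1 and L_s norms of t ↦ K(x - t) for the finite measure |φ| dt is Hölder's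
      -- inequality in the form needed; the total mass A yields the factor A^(S-1).
      set ν := periodMeasure.withDensity (fun t => ‖φ t‖ₑ)
      have hKx : Continuous fun t => K (x - t) := hK.comp (by fun_prop)
      have hν : ν univ = A := by simp [ν, hφ1]
      have h1 := eLpNorm_le_eLpNorm_mul_rpow_measure_univ (μ := ν) hs
        hKx.aestronglyMeasurable
      rw [eLpNorm_one_eq_lintegral_enorm, hν, ENNReal.toReal_one,
        lintegral_withDensity_eq_lintegral_mul₀ hφm hKx.enorm.measurable.aemeasurable,
        eLpNorm_eq_lintegral_rpow_enorm_toReal (by positivity) hs',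
        lintegral_withDensity_eq_lintegral_mul₀ hφm
          (hKx.enorm.measurable.pow_const _).aemeasurable] at h1
      calc _ ≤ (∫⁻ t, ‖φ t‖ₑ * ‖K (x - t)‖ₑ ∂periodMeasure) ^ S := by gcongr; exact hb x
        _ ≤ _ := ENNReal.rpow_le_rpow h1 hS0.le
        _ = _ := by
          rw [ENNReal.mul_rpow_of_nonneg _ _ hS0.le, ← ENNReal.rpow_mul, ← ENNReal.rpow_mul,
            mul_comm, ← hSdef]
          congr 1
          · congr 1; field_simp
          · rw [one_div_mul_cancel hS0.ne', ENNReal.rpow_one]; rfl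
    have hmeas : AEMeasurable (Function.uncurry fun x t => ‖φ t‖ₑ * ‖K (x - t)‖ₑ ^ S)
        (periodMeasure.prod periodMeasure) := by
      refine AEMeasurable.mul (hφm.comp_quasiMeasurePreserving
        Measure.quasiMeasurePreserving_snd) ?_
      have : Continuous fun z : ℝ × ℝ => K (z.1 - z.2) := hK.comp (by fun_prop)
      exact (this.enorm.measurable.pow_const _).aemeasurable
    rw [normL_eq_lintegral hs hs', normL_eq_lintegral hs hs', ← hSdef]
    calc _ ≤ (∫⁻ x, A ^ (S - 1) * ∫⁻ t, ‖φ t‖ₑ * ‖K (x - t)‖ₑ ^ S ∂periodMeasure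
          ∂periodMeasure) ^ (1 / S) := by
          gcongr with x; exact hJ x
      _ = (A ^ (S - 1) * (A * ∫⁻ u, ‖K u‖ₑ ^ S ∂periodMeasure)) ^ (1 / S) := by
          rw [lintegral_const_mul' _ _ (ENNReal.rpow_ne_top_of_nonneg (by linarith) hA),
            lintegral_lintegral_swap hmeas, hφ1, ← lintegral_mul_const'' _ hφm]
          congr 3
          ext t
          rw [lintegral_const_mul' _ _ enorm_ne_top]
          congr 1
          exact lintegral_period_add (F := fun u => ‖K u‖ₑ ^ S)
            (fun x => by simp only [hKp x]) (-t)
      _ = _ := by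
          rw [← mul_assoc, ENNReal.mul_rpow_of_nonneg _ _ (by positivity)]
          congr 1
          have : A ^ (S - 1) * A = A ^ S := by
            conv_lhs => rw [← ENNReal.rpow_one A, ← ENNReal.rpow_mul, one_mul,
              ← ENNReal.rpow_add_of_nonneg _ _ (by linarith) zero_le_one]
            congr 1; ring
          rw [this, ← ENNReal.rpow_mul, mul_one_div_cancel hS0.ne', ENNReal.rpow_one]

/-! ### Averaging over the phase of a modulated function -/

/-- Norm of a modulated function: the oscillating factor `cos (M u + …)` asymptotically acts as
multiplication of the norm by the mean value of `|cos|`. -/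
lemma normL_modulated_le {s : ℝ≥0∞} (hs : 1 ≤ s) (hs' : s ≠ ⊤) {G : ℝ → ℂ} (hG : Continuous G)
    (hGp : Function.Periodic G (2 * π)) {M : ℕ} (hM : 0 < M) (γ : ℝ) {δ : ℝ≥0∞}
    (hδ : ∀ v, |v| ≤ π / M → normL s (fun u => ‖G (u + v) - G u‖) ≤ δ) :
    normL s (fun u => (Complex.exp ((M * u - γ : ℝ) * Complex.I) * G u).re) ≤
      ENNReal.ofReal ((2 * π) ^ (-(s⁻¹).toReal)) * normL s cos * normL s (fun u => ‖G u‖) + δ := by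
  have hS := one_le_toReal hs hs'
  set S := s.toReal with hSdef
  have hS0 : 0 < S := by linarith
  let h : ℝ → ℝ → ℝ := fun θ u => (Complex.exp ((M * u + θ - γ : ℝ) * Complex.I) * G u).re
  have hh : ∀ θ u, h θ u = ‖G u‖ * cos (θ + (M * u - γ + (G u).arg)) := by
    intro θ u
    simp only [h]
    conv_lhs => rw [← Complex.norm_mul_exp_arg_mul_I (G u)]
    rw [mul_left_comm, ← Complex.exp_add, Complex.re_ofReal_mul, ← add_mul, ← Complex.ofReal_add,
      Complex.exp_ofReal_mul_I_re]
    congr 2; ring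
  have hcont : Continuous (Function.uncurry h) := by
    simp only [h, Function.uncurry_def]
    fun_prop
  have hcosp : Function.Periodic (fun u : ℝ => ‖cos u‖ₑ ^ S) (2 * π) := fun x => by
    simp only [cos_periodic x]
  have hFub : ∫⁻ θ, ∫⁻ u, ‖h θ u‖ₑ ^ S ∂periodMeasure ∂periodMeasure =
      (∫⁻ u, ‖G u‖ₑ ^ S ∂periodMeasure) * ∫⁻ u, ‖cos u‖ₑ ^ S ∂periodMeasure := by
    rw [lintegral_lintegral_swap ((hcont.enorm.measurable.pow_const _).aemeasurable),
      ← lintegral_mul_const'' _ (hG.enorm.measurable.pow_const _).aemeasurable]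
    congr 1; ext u
    simp only [hh, enorm_mul, ENNReal.mul_rpow_of_nonneg _ _ hS0.le, enorm_norm]
    rw [lintegral_const_mul' _ _ (ENNReal.rpow_ne_top_of_nonneg hS0.le enorm_ne_top)]
    congr 1
    exact lintegral_period_add hcosp _
  have h2π : periodMeasure univ = ENNReal.ofReal (2 * π) := periodMeasure_univ
  -- Some phase is no worse than the average; by Fubini the average factors into the integrals of
  -- |G|^S and |cos|^S.
  obtain ⟨θ, hθ, hθle⟩ := exists_le_setLAverage (μ := volume) (s := Ioc (-π) π)
    (f := fun θ => ∫⁻ u, ‖h θ u‖ₑ ^ S ∂periodMeasure)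
    (by simp [Real.volume_Ioc, pi_pos]) (by simp [Real.volume_Ioc])
    ((hcont.enorm.measurable.pow_const _).lintegral_prod_right').aemeasurable
  rw [setLAverage_eq, ← Measure.restrict_apply_univ, ← periodMeasure, hFub, h2π] at hθle
  have hM' : (0 : ℝ) < M := by exact_mod_cast hM
  -- Shifting u by v advances M u by exactly θ, while G moves only by a distance of at most π / M.
  set v := θ / M with hv
  have hMv : (M : ℝ) * v = θ := by rw [hv]; field_simp
  have hvle : |v| ≤ π / M := by
    rw [hv, abs_div, Nat.abs_cast]
    gcongr
    exact abs_le.2 ⟨hθ.1.le, hθ.2⟩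
  -- The frequency M is an integer, so the modulated function stays 2π-periodic and its norm is
  -- translation invariant.
  have hper : Function.Periodic
      (fun u => (Complex.exp ((M * u - γ : ℝ) * Complex.I) * G u).re) (2 * π) := by
    intro u
    simp only [hGp u]
    congr 2
    rw [Complex.exp_eq_exp_iff_exists_int]
    exact ⟨M, by push_cast; ring⟩
  have hcθ : Continuous (h θ) := by simp only [h]; fun_prop
  have hcd : Continuous fun u => ‖G (u + v) - G u‖ := by fun_prop
  rw [← normL_comp_add hs hs' hper v]
  have hsplit : normL s (fun u => (Complex.exp ((M * (u + v) - γ : ℝ) * Complex.I) *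
      G (u + v)).re) ≤ normL s (fun u => |h θ u| + ‖G (u + v) - G u‖) := by
    apply normL_mono
    intro u
    rw [abs_of_nonneg (by positivity : 0 ≤ |h θ u| + ‖G (u + v) - G u‖)]
    have e1 : (M * (u + v) - γ : ℝ) = M * u + θ - γ := by rw [mul_add, hMv]
    rw [e1]
    have e2 : (Complex.exp ((M * u + θ - γ : ℝ) * Complex.I) * G (u + v)).re = h θ u +
        (Complex.exp ((M * u + θ - γ : ℝ) * Complex.I) * (G (u + v) - G u)).re := by
      simp only [h]; rw [← Complex.add_re]; congr 1; ring
    rw [e2]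
    refine (abs_add_le _ _).trans ?_
    gcongr
    refine (Complex.abs_re_le_norm _).trans ?_
    rw [norm_mul, Complex.norm_exp_ofReal_mul_I, one_mul]
  refine hsplit.trans ((normL_add_le hs hcθ.abs hcd).trans ?_)
  gcongr
  · rw [normL_eq_lintegral hs hs', normL_eq_lintegral hs hs', normL_eq_lintegral hs hs', ← hSdef]
    simp only [enorm_abs, enorm_norm]
    refine (ENNReal.rpow_le_rpow hθle (by positivity : 0 ≤ 1 / S)).trans_eq ?_
    rw [ENNReal.div_rpow_of_nonneg _ _ (by positivity),
      ENNReal.mul_rpow_of_nonneg _ _ (by positivity), ENNReal.div_eq_inv_mul,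
      ENNReal.ofReal_rpow_of_pos (by positivity), ← ENNReal.ofReal_inv_of_pos (by positivity),
      ← Real.rpow_neg (by positivity), ENNReal.toReal_inv, ← hSdef, one_div, mul_assoc]
    congr 1
    exact mul_comm _ _
  · exact hδ v hvle

/-! ### Fourier coefficients, uniqueness and absolutely convergent series -/

lemma intervalIntegral_eq_period (f : ℝ → ℝ) :
    ∫ t in (-π)..π, f t = ∫ t, f t ∂periodMeasure := by
  rw [intervalIntegral.integral_of_le (by linarith [pi_pos]), periodMeasure]

lemma integrable_period_of_continuous {f : ℝ → ℝ} (hf : Continuous f) :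
    Integrable f periodMeasure :=
  (hf.integrableOn_Icc (a := -π) (b := π)).mono_set Ioc_subset_Icc_self

lemma integrable_mul_of_bound {f g : ℝ → ℝ} (hf : Integrable f periodMeasure) (hg : Continuous g)
    {c : ℝ} (hc : ∀ x, |g x| ≤ c) : Integrable (fun t => f t * g t) periodMeasure :=
  hf.mul_bdd (c := c) hg.aestronglyMeasurable (ae_of_all _ hc)

lemma integrable_mul_cos {f : ℝ → ℝ} (hf : Integrable f periodMeasure) (a b : ℝ) :
    Integrable (fun t => f t * cos (a * t + b)) periodMeasure :=
  integrable_mul_of_bound hf (by fun_prop) fun _ => abs_cos_le_one _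

lemma integrable_mul_sin {f : ℝ → ℝ} (hf : Integrable f periodMeasure) (a b : ℝ) :
    Integrable (fun t => f t * sin (a * t + b)) periodMeasure :=
  integrable_mul_of_bound hf (by fun_prop) fun _ => abs_sin_le_one _

/-- An integrable function on the period whose Fourier coefficients all vanish is zero a.e. -/
lemma ae_eq_zero_of_coef_eq_zero {g : ℝ → ℝ} (hg : Integrable g periodMeasure)
    (hc : ∀ k : ℕ, ∫ t, g t * cos (k * t) ∂periodMeasure = 0)
    (hs : ∀ k : ℕ, ∫ t, g t * sin (k * t) ∂periodMeasure = 0) :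
    g =ᵐ[periodMeasure] 0 := by
  have hT : Fact (0 < 2 * π) := ⟨by positivity⟩
  have hint : ∀ c : C(AddCircle (2 * π), ℂ),
      Integrable (fun t : ℝ => (g t : ℂ) * c (t : AddCircle (2 * π))) periodMeasure := fun c =>
    hg.ofReal.mul_bdd (c := ‖c‖)
      ((c.continuous.comp (AddCircle.continuous_mk' _)).aestronglyMeasurable)
      (ae_of_all _ fun t => c.norm_coe_le_norm _)
  let Λ : C(AddCircle (2 * π), ℂ) →ₗ[ℂ] ℂ :=
    { toFun := fun c => ∫ t, (g t : ℂ) * c (t : AddCircle (2 * π)) ∂periodMeasure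
      map_add' := fun c d => by
        rw [← integral_add (hint c) (hint d)]
        congr 1; ext t; simp [mul_add]
      map_smul' := fun a c => by
        rw [RingHom.id_apply, smul_eq_mul, ← integral_const_mul]
        congr 1; ext t; simp; ring }
  have hΛ : ∀ c, ‖Λ c‖ ≤ (∫ t, |g t| ∂periodMeasure) * ‖c‖ := by
    intro c
    rw [← integral_mul_const]
    refine (norm_integral_le_integral_norm _).trans
      (integral_mono (hint c).norm (hg.norm.mul_const _) fun t => ?_)
    simp only [norm_mul, Complex.norm_real, Real.norm_eq_abs]
    gcongr
    exact c.norm_coe_le_norm _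
  let Λ' := Λ.mkContinuous _ hΛ
  -- The functional c ↦ ∫ g c is continuous and kills every character; the characters span a dense
  -- subspace, so it vanishes.
  have hker : (⊤ : Submodule ℂ C(AddCircle (2 * π), ℂ)) ≤ Λ'.ker := by
    rw [← span_fourier_closure_eq_top]
    refine Submodule.topologicalClosure_minimal _ ?_ Λ'.isClosed_ker
    rw [Submodule.span_le]
    rintro _ ⟨n, rfl⟩
    change ∫ t, (g t : ℂ) * fourier n (t : AddCircle (2 * π)) ∂periodMeasure = 0
    have hpt : ∀ t : ℝ, (g t : ℂ) * fourier n (t : AddCircle (2 * π)) =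
        ((g t * cos (n * t) : ℝ) : ℂ) + ((g t * sin (n * t) : ℝ) : ℂ) * Complex.I := by
      intro t
      rw [fourier_coe_apply]
      have : 2 * π * Complex.I * n * t / ((2 * π : ℝ) : ℂ) = ((n * t : ℝ) : ℂ) * Complex.I := by
        have : (π : ℂ) ≠ 0 := by exact_mod_cast pi_ne_zero
        push_cast; field_simp
      rw [this, Complex.exp_mul_I]
      push_cast; ring
    simp only [hpt]
    have i1 : Integrable (fun t => g t * cos (n * t)) periodMeasure := by
      simpa using integrable_mul_cos hg n 0
    have i2 : Integrable (fun t => g t * sin (n * t)) periodMeasure := by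
      simpa using integrable_mul_sin hg n 0
    rw [integral_add i1.ofReal (i2.ofReal.mul_const _), integral_mul_const,
      integral_complex_ofReal, integral_complex_ofReal]
    have z1 : ∫ t, g t * cos (n * t) ∂periodMeasure = 0 := by
      obtain ⟨k, rfl | rfl⟩ := n.eq_nat_or_neg
      · simpa using hc k
      · simpa [neg_mul] using hc k
    have z2 : ∫ t, g t * sin (n * t) ∂periodMeasure = 0 := by
      obtain ⟨k, rfl | rfl⟩ := n.eq_nat_or_neg
      · simpa using hs k
      · simpa [neg_mul, integral_neg] using hs k
    simp [z1, z2]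
  have hzero : ∀ c : C(AddCircle (2 * π), ℂ),
      ∫ t, (g t : ℂ) * c (t : AddCircle (2 * π)) ∂periodMeasure = 0 := fun c =>
    hker (Submodule.mem_top (x := c))
  have hIoc : IntegrableOn g (Ioc (-π) π) := hg
  have key := isOpen_Ioo.ae_eq_zero_of_integral_contDiff_smul_eq_zero (μ := volume) (f := g)
    (U := Ioo (-π) π) (hIoc.mono_set Ioo_subset_Ioc_self).locallyIntegrableOn ?_
  · rw [periodMeasure, ← Measure.restrict_congr_set Ioo_ae_eq_Ioc]
    exact (ae_restrict_iff' measurableSet_Ioo).2 key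
  -- A test function supported inside the open period vanishes at both ends, hence descends to a
  -- continuous function on the circle.
  · intro h hd _ hsupp
    have hout : ∀ x, x ∉ Ioo (-π) π → h x = 0 := fun x hx =>
      image_eq_zero_of_notMem_tsupport fun hx' => hx (hsupp hx')
    have e : -π + 2 * π = π := by ring
    have hcont : Continuous (AddCircle.liftIoc (2 * π) (-π) (fun x => (h x : ℂ))) := by
      apply AddCircle.liftIoc_continuous
      · rw [e, hout (-π) (by simp), hout π (by simp)]
      · exact (Complex.continuous_ofReal.comp hd.continuous).continuousOn
    have hz := hzero ⟨_, hcont⟩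
    have hz' : ∫ t, ((h t * g t : ℝ) : ℂ) ∂periodMeasure = 0 := by
      rw [← hz, periodMeasure]
      refine setIntegral_congr_fun measurableSet_Ioc fun t ht => ?_
      simp only [ContinuousMap.coe_mk]
      rw [AddCircle.liftIoc_coe_apply (by rwa [e])]
      push_cast; ring
    rw [integral_complex_ofReal] at hz'
    have hz2 : ∫ t, h t * g t ∂periodMeasure = 0 := by exact_mod_cast hz'
    simp only [smul_eq_mul]
    rw [← hz2, periodMeasure]
    symm
    apply setIntegral_eq_integral_of_forall_compl_eq_zero
    intro x hx
    rw [hout x (fun hx' => hx (Ioo_subset_Ioc_self hx')), zero_mul]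

lemma integral_cos_int (n : ℤ) (hn : n ≠ 0) (c : ℝ) :
    ∫ t, cos (n * t + c) ∂periodMeasure = 0 := by
  have hn' : (n : ℝ) ≠ 0 := by exact_mod_cast hn
  rw [← intervalIntegral_eq_period, intervalIntegral.integral_comp_mul_add _ hn', integral_cos]
  have : n * π + c = (n * -π + c) + n * (2 * π) := by ring
  rw [this, sin_add_int_mul_two_pi, sub_self, smul_zero]

lemma integral_cos_mul_cos (j k : ℕ) (hj : 1 ≤ j) (a b : ℝ) :
    ∫ t, cos (j * t + a) * cos (k * t + b) ∂periodMeasure =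
      if j = k then π * cos (a - b) else 0 := by
  have h1 : ∀ t : ℝ, cos (j * t + a) * cos (k * t + b) =
      (1 / 2) * cos (((j + k : ℤ) : ℝ) * t + (a + b)) +
        (1 / 2) * cos (((j - k : ℤ) : ℝ) * t + (a - b)) := by
    intro t
    have e1 : ((j + k : ℤ) : ℝ) * t + (a + b) = (j * t + a) + (k * t + b) := by push_cast; ring
    have e2 : ((j - k : ℤ) : ℝ) * t + (a - b) = (j * t + a) - (k * t + b) := by push_cast; ring
    rw [e1, e2, cos_add (j * t + a), cos_sub (j * t + a)]; ring
  simp only [h1]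
  rw [integral_add (integrable_period_of_continuous (by fun_prop))
    (integrable_period_of_continuous (by fun_prop)), integral_const_mul, integral_const_mul,
    integral_cos_int _ (by omega)]
  split_ifs with h
  · subst h
    simp only [sub_self, Int.cast_zero, zero_mul, zero_add, mul_zero, integral_const, smul_eq_mul,
      measureReal_def, periodMeasure_univ]
    rw [ENNReal.toReal_ofReal (by positivity)]
    ring
  · rw [integral_cos_int _ (by omega)]; ring

lemma integral_sin_mul_cos (j k : ℕ) (hj : 1 ≤ j) (b : ℝ) :
    ∫ t, sin (j * t) * cos (k * t + b) ∂periodMeasure =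
      if j = k then -(π * sin b) else 0 := by
  have := integral_cos_mul_cos j k hj (-(π / 2)) b
  simp only [← sub_eq_add_neg, cos_sub_pi_div_two] at this
  rw [this, show -(π / 2) - b = -(b + π / 2) by ring, cos_neg, cos_add_pi_div_two]
  simp

lemma integral_mul_cos {f : ℝ → ℝ} (hf : Integrable f periodMeasure) (k : ℕ) (b : ℝ) :
    ∫ t, f t * cos (k * t + b) ∂periodMeasure =
      π * (coefA f k * cos b - coefB f k * sin b) := by
  have h1 : ∀ t, f t * cos (k * t + b) = cos b * (f t * cos (k * t)) - sin b * (f t * sin (k * t)) :=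
    fun t => by rw [cos_add]; ring
  have i1 := integrable_mul_cos hf k 0
  have i2 := integrable_mul_sin hf k 0
  simp only [add_zero] at i1 i2
  simp only [h1]
  rw [integral_sub (i1.const_mul _) (i2.const_mul _), integral_const_mul, integral_const_mul,
    coefA, coefB, intervalIntegral_eq_period, intervalIntegral_eq_period]
  field_simp

/-- The harmonic of order `j` in the Fourier series of `f`. -/
noncomputable def harmonic (f : ℝ → ℝ) (j : ℕ) (x : ℝ) : ℝ :=
  coefA f j * cos (j * x) + coefB f j * sin (j * x)

lemma continuous_harmonic (f : ℝ → ℝ) (j : ℕ) : Continuous (harmonic f j) := by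
  unfold harmonic; fun_prop

lemma integral_harmonic_mul_cos (f : ℝ → ℝ) (j k : ℕ) (hj : 1 ≤ j) (b : ℝ) :
    ∫ t, harmonic f j t * cos (k * t + b) ∂periodMeasure =
      if j = k then π * (coefA f j * cos b - coefB f j * sin b) else 0 := by
  have h1 : ∀ t, harmonic f j t * cos (k * t + b) =
      coefA f j * (cos (j * t + 0) * cos (k * t + b)) +
        coefB f j * (sin (j * t) * cos (k * t + b)) := fun t => by
    rw [harmonic, add_zero]; ring
  simp only [h1]
  rw [integral_add (integrable_period_of_continuous (by fun_prop))
    (integrable_period_of_continuous (by fun_prop)), integral_const_mul, integral_const_mul,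
    integral_cos_mul_cos j k hj, integral_sin_mul_cos j k hj]
  split_ifs
  · rw [zero_sub, cos_neg]; ring
  · ring

/-- An integrable function with absolutely convergent Fourier series equals its sum a.e. -/
lemma ae_eq_tsum_harmonic {f : ℝ → ℝ} (hf : Integrable f periodMeasure) {u : ℕ → ℝ}
    (hu : Summable u) (hb : ∀ j x, |harmonic f (j + 1) x| ≤ u j) :
    f =ᵐ[periodMeasure] fun x => coefA f 0 / 2 + ∑' j, harmonic f (j + 1) x := by
  have hFc : Continuous fun x => ∑' j, harmonic f (j + 1) x :=
    continuous_tsum (fun j => continuous_harmonic f _) hu hb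
  set F : ℝ → ℝ := fun x => coefA f 0 / 2 + ∑' j, harmonic f (j + 1) x with hF
  have hFi : Integrable F periodMeasure := integrable_period_of_continuous (by fun_prop)
  have hFcos : ∀ (k : ℕ) (b : ℝ), ∫ t, F t * cos (k * t + b) ∂periodMeasure =
      π * (coefA f k * cos b - coefB f k * sin b) := by
    intro k b
    have hs := hasSum_integral_of_summable_integral_norm (μ := periodMeasure)
      (F := fun j t => harmonic f (j + 1) t * cos (k * t + b))
      (fun j => integrable_period_of_continuous ((continuous_harmonic f _).mul (by fun_prop)))
      (by
        refine Summable.of_nonneg_of_le (fun j => integral_nonneg fun t => norm_nonneg _)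
          (fun j => ?_) (hu.mul_left (2 * π))
        have := norm_setIntegral_le_of_norm_le_const (μ := volume) (s := Ioc (-π) π) (C := u j)
          (f := fun t => ‖harmonic f (j + 1) t * cos (k * t + b)‖)
          (by simp [Real.volume_Ioc]) (fun t _ => by
            rw [norm_norm, norm_mul]
            calc _ ≤ u j * 1 := mul_le_mul (hb j t) (abs_cos_le_one _) (abs_nonneg _)
                    ((abs_nonneg _).trans (hb j t))
              _ = u j := mul_one _)
        refine (le_abs_self _).trans (this.trans_eq ?_)
        rw [measureReal_def, Real.volume_Ioc, ENNReal.toReal_ofReal (by linarith [pi_pos])]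
        ring)
    simp only [integral_harmonic_mul_cos f _ k (Nat.le_add_left 1 _) b] at hs
    have h1 : ∀ t, F t * cos (k * t + b) = coefA f 0 / 2 * cos (k * t + b) +
        ∑' j, harmonic f (j + 1) t * cos (k * t + b) := fun t => by
      rw [hF, tsum_mul_right]; ring
    have hc2 : Continuous fun t => ∑' j, harmonic f (j + 1) t * cos (k * t + b) := by
      simp only [tsum_mul_right]; fun_prop
    simp only [h1]
    rw [integral_add (integrable_period_of_continuous (by fun_prop))
      (integrable_period_of_continuous hc2), integral_const_mul, ← hs.tsum_eq]
    -- The harmonics are indexed by j + 1, so for k = 0 only the constant term contributes;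
    -- otherwise only j = k - 1 does, and the constant term drops out.
    rcases Nat.eq_zero_or_pos k with rfl | hk
    · simp only [Nat.add_eq_zero_iff, one_ne_zero, and_false, if_false, tsum_zero, Nat.cast_zero,
        zero_mul, zero_add, integral_const, smul_eq_mul, measureReal_def, periodMeasure_univ]
      rw [ENNReal.toReal_ofReal (by positivity)]
      simp [coefB]
      ring
    · have := integral_cos_int k (by omega) b
      rw [Int.cast_natCast] at this
      rw [this, tsum_eq_single (k - 1) (fun j hj => if_neg (by omega)),
        if_pos (by omega), show k - 1 + 1 = k by omega]
      ring
  have hz : ∀ (k : ℕ) (b : ℝ), ∫ t, (f t - F t) * cos (k * t + b) ∂periodMeasure = 0 := by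
    intro k b
    simp only [sub_mul]
    rw [integral_sub (integrable_mul_cos hf _ _) (integrable_mul_cos hFi _ _), hFcos,
      integral_mul_cos hf, sub_self]
  have := ae_eq_zero_of_coef_eq_zero (hf.sub hFi) (fun k => by simpa using hz k 0)
    (fun k => by
      have := hz k (-(π / 2))
      simpa only [← sub_eq_add_neg, cos_sub_pi_div_two, Pi.sub_apply] using this)
  filter_upwards [this] with x hx
  simpa [sub_eq_zero] using hx

lemma abs_coef_le {f : ℝ → ℝ} (hf : Integrable f periodMeasure) (k : ℕ) :
    |coefA f k| ≤ ∫ t, |f t| ∂periodMeasure ∧ |coefB f k| ≤ ∫ t, |f t| ∂periodMeasure := by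
  have hπ : |1 / π| ≤ 1 := by
    rw [abs_of_pos (by positivity), div_le_one pi_pos]; linarith [pi_gt_three]
  have key : ∀ g : ℝ → ℝ, (∀ t, |g t| ≤ 1) →
      |1 / π * ∫ t, f t * g t ∂periodMeasure| ≤ ∫ t, |f t| ∂periodMeasure := by
    intro g hg
    have : |∫ t, f t * g t ∂periodMeasure| ≤ ∫ t, |f t| ∂periodMeasure := by
      refine norm_integral_le_of_norm_le (f := fun t => f t * g t) hf.norm
        (ae_of_all _ fun t => ?_)
      rw [norm_mul]
      exact mul_le_of_le_one_right (norm_nonneg _) (hg t)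
    rw [abs_mul]
    calc _ ≤ 1 * ∫ t, |f t| ∂periodMeasure := by gcongr
      _ = _ := one_mul _
  rw [coefA, coefB, intervalIntegral_eq_period, intervalIntegral_eq_period]
  exact ⟨key _ fun t => abs_cos_le_one _, key _ fun t => abs_sin_le_one _⟩

/-! ### Integral representation of the deviation -/

/-- The harmonics of `f` in terms of its `(ψ, β)`-derivative. -/
lemma IsPsiBetaDerivative.harmonic_eq {ψ : ℕ → ℝ} {β : ℝ} {f φ : ℝ → ℝ}
    (h : IsPsiBetaDerivative ψ β f φ) {j : ℕ} (hj : 1 ≤ j) (hψ : 0 < ψ j) (x : ℝ) :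
    harmonic f j x =
      ψ j * (coefA φ j * cos (j * x - β * π / 2) + coefB φ j * sin (j * x - β * π / 2)) := by
  have hj' : (j : ℝ) ≠ 0 := by positivity
  -- Evaluating at the shifted point moves the phase βπ/2 from the harmonic of f to that of φ.
  have := h.2.2 j hj (x - β * π / 2 / j)
  have e : (j : ℝ) * (x - β * π / 2 / j) = j * x - β * π / 2 := by field_simp
  rw [e, sub_add_cancel] at this
  rw [this, harmonic]
  field_simp

/-- Orthogonality to all frequencies from M on is what allows the approximating polynomial to be
subtracted from φ without changing the convolution. -/
lemma integral_trigPoly_mul_cos {M : ℕ} {T : ℝ → ℝ} (hT : T ∈ trigPoly M) {j : ℕ} (hj : 1 ≤ j)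
    (hMj : M ≤ j) (b : ℝ) : ∫ t, T t * cos (j * t + b) ∂periodMeasure = 0 := by
  obtain ⟨a, c, hT⟩ := hT
  have h1 : ∀ t, T t * cos (j * t + b) = ∑ k ∈ Finset.range M,
      (a k * (cos (j * t + b) * cos (k * t + 0)) +
        c k * (cos (j * t + b) * cos (k * t + -(π / 2)))) := by
    intro t
    rw [hT, Finset.sum_mul]
    refine Finset.sum_congr rfl fun k _ => ?_
    rw [← sub_eq_add_neg, cos_sub_pi_div_two, add_zero]; ring
  simp only [h1]
  rw [integral_finsetSum _ fun k _ => integrable_period_of_continuous (by fun_prop)]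
  refine Finset.sum_eq_zero fun k hk => ?_
  have hne : j ≠ k := by have := Finset.mem_range.1 hk; omega
  rw [integral_add (integrable_period_of_continuous (by fun_prop))
    (integrable_period_of_continuous (by fun_prop)), integral_const_mul, integral_const_mul,
    integral_cos_mul_cos j k hj, integral_cos_mul_cos j k hj, if_neg hne, if_neg hne]
  ring

lemma continuous_of_mem_trigPoly {M : ℕ} {T : ℝ → ℝ} (hT : T ∈ trigPoly M) : Continuous T := by
  obtain ⟨a, c, hT⟩ := hT
  rw [funext hT]
  fun_prop

/-- The weights `min (i + 1, p)` that de la Vallée Poussin means put on the remaining harmonics. -/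
def weight (p i : ℕ) : ℝ := (min (i + 1) p : ℕ)

lemma weight_nonneg (p i : ℕ) : 0 ≤ weight p i := Nat.cast_nonneg _

lemma weight_le_succ (p i : ℕ) : weight p i ≤ i + 1 := by
  unfold weight; exact_mod_cast min_le_left _ _

lemma weight_le (p i : ℕ) : weight p i ≤ p := by
  unfold weight; exact_mod_cast min_le_right _ _

lemma weight_succ (p i : ℕ) : weight (p + 1) i = weight p i + if p ≤ i then 1 else 0 := by
  unfold weight
  split_ifs with h
  · rw [min_eq_right (by omega), min_eq_right (by omega)]; push_cast; ring
  · rw [min_eq_left (by omega), min_eq_left (by omega)]; push_cast; ring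

/-- The term d i occurs in the tail starting at l exactly when l ≤ i, hence in min(i + 1, p) of the
first p tails. This serves both the Fourier tails and the geometric series. -/
lemma hasSum_weight_mul {E : Type*} [NormedAddCommGroup E] [NormedSpace ℝ E]
    {d : ℕ → E} {t : ℕ → E} (h : ∀ l, HasSum (fun i => d (i + l)) (t l)) (p : ℕ) :
    HasSum (fun i => weight p i • d i) (∑ l ∈ Finset.range p, t l) := by
  induction p with
  | zero => simp [weight]
  | succ p ih =>
    rw [Finset.sum_range_succ]
    have h1 : HasSum (fun i => if p ≤ i then d i else 0) (t p) := by
      rw [← (add_left_injective p).hasSum_iff]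
      · simpa [Function.comp_def] using h p
      · intro i hi
        rw [if_neg]
        intro hpi
        exact hi ⟨i - p, by simp [Nat.sub_add_cancel hpi]⟩
    convert! ih.add h1 using 2 with i
    rw [weight_succ, add_smul]
    split_ifs <;> simp

/-- The kernel of the remainder of the de la Vallée Poussin sum. -/
noncomputable def kernel (ψ : ℕ → ℝ) (γ : ℝ) (M p : ℕ) (u : ℝ) : ℝ :=
  ∑' i : ℕ, weight p i * ψ (M + i) * cos ((M + i : ℕ) * u - γ)

/-- Ratio test, with limiting ratio q. The factor i + 1 dominates the weights for every p at once.
-/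
lemma ClassD.summable_succ_mul {q : ℝ} {ψ : ℕ → ℝ} (hψ : ClassD q ψ) (hq : q < 1) {M : ℕ}
    (hM : 1 ≤ M) : Summable fun i : ℕ => ((i : ℝ) + 1) * ψ (M + i) := by
  have hpos : ∀ i, 0 < ψ (M + i) := fun i => hψ.1 _ (by omega)
  refine summable_of_ratio_test_tendsto_lt_one hq
    (Eventually.of_forall fun i => (mul_pos (by positivity) (hpos i)).ne') ?_
  have h1 : Tendsto (fun i : ℕ => ψ (i + M + 1) / ψ (i + M)) atTop (𝓝 q) :=
    (tendsto_add_atTop_iff_nat M).2 hψ.2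
  have h2 : Tendsto (fun i : ℕ => 1 + 1 / ((i : ℝ) + 1)) atTop (𝓝 (1 + 0)) :=
    tendsto_one_div_add_atTop_nhds_zero_nat.const_add 1
  have h3 := h2.mul h1
  rw [add_zero, one_mul] at h3
  refine h3.congr fun i => ?_
  have := hpos i
  have := hpos (i + 1)
  rw [Real.norm_of_nonneg (by positivity), Real.norm_of_nonneg (by positivity), add_comm i M,
    add_assoc]
  push_cast
  field_simp

lemma ClassD.abs_kernel_term_le {q : ℝ} {ψ : ℕ → ℝ} (hψ : ClassD q ψ) (γ : ℝ) {M : ℕ}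
    (hM : 1 ≤ M) (p i : ℕ) (u : ℝ) :
    |weight p i * ψ (M + i) * cos ((M + i : ℕ) * u - γ)| ≤ ((i : ℝ) + 1) * ψ (M + i) := by
  have hpos : 0 < ψ (M + i) := hψ.1 _ (by omega)
  rw [abs_mul, abs_of_nonneg (mul_nonneg (weight_nonneg _ _) hpos.le)]
  refine (mul_le_of_le_one_right (mul_nonneg (weight_nonneg _ _) hpos.le)
    (abs_cos_le_one _)).trans ?_
  gcongr
  exact weight_le_succ _ _

lemma ClassD.continuous_kernel {q : ℝ} {ψ : ℕ → ℝ} (hψ : ClassD q ψ) (hq : q < 1) (γ : ℝ) {M : ℕ}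
    (hM : 1 ≤ M) (p : ℕ) : Continuous (kernel ψ γ M p) :=
  continuous_tsum (fun i => by fun_prop) (hψ.summable_succ_mul hq hM)
    fun i u => hψ.abs_kernel_term_le γ hM p i u

lemma kernel_periodic (ψ : ℕ → ℝ) (γ : ℝ) (M p : ℕ) :
    Function.Periodic (kernel ψ γ M p) (2 * π) := by
  intro u
  unfold kernel
  congr 1; ext i
  rw [show ((M + i : ℕ) : ℝ) * (u + 2 * π) - γ =
    ((M + i : ℕ) * u - γ) + (M + i : ℕ) * (2 * π) by ring, cos_add_nat_mul_two_pi]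

lemma ClassD.abs_kernel_le {q : ℝ} {ψ : ℕ → ℝ} (hψ : ClassD q ψ) (hq : q < 1) (γ : ℝ) {M : ℕ}
    (hM : 1 ≤ M) (p : ℕ) (u : ℝ) :
    |kernel ψ γ M p u| ≤ ∑' i : ℕ, ((i : ℝ) + 1) * ψ (M + i) :=
  tsum_of_norm_bounded (f := fun i => weight p i * ψ (M + i) * cos ((M + i : ℕ) * u - γ))
    (hψ.summable_succ_mul hq hM).hasSum
    fun i => hψ.abs_kernel_term_le γ hM p i u

lemma fourierSum_eq (f : ℝ → ℝ) (k : ℕ) (x : ℝ) :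
    fourierSum k f x = coefA f 0 / 2 + ∑ j ∈ Finset.range k, harmonic f (j + 1) x := by
  unfold fourierSum
  congr 1
  induction k with
  | zero => simp
  | succ k ih =>
    rw [Finset.sum_Icc_succ_top (by omega), ih, Finset.sum_range_succ, harmonic]

/-- Integral representation of the deviation of a de la Vallée Poussin sum. -/
lemma sub_valleePoussinSum_ae_eq {q : ℝ} {ψ : ℕ → ℝ} (hψ : ClassD q ψ) (hq : q < 1) {β : ℝ}
    {n p : ℕ} (hp : 1 ≤ p) (hpn : p ≤ n) {f φ : ℝ → ℝ} (hf : PeriodicL1 f)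
    (hφ : IsPsiBetaDerivative ψ β f φ) {T : ℝ → ℝ} (hT : T ∈ trigPoly (n - p + 1)) :
    (fun x => f x - valleePoussinSum n p f x) =ᵐ[periodMeasure] fun x => (1 / (π * p)) *
      ∫ t, (φ t - T t) * kernel ψ (β * π / 2) (n - p + 1) p (x - t) ∂periodMeasure := by
  set γ := β * π / 2 with hγ
  set M := n - p + 1 with hM
  have hM1 : 1 ≤ M := by omega
  have hφi : Integrable φ periodMeasure := hφ.1.2
  have hTi : Integrable T periodMeasure :=
    integrable_period_of_continuous (continuous_of_mem_trigPoly hT)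
  set D := ∫ t, |φ t| ∂periodMeasure
  have hψs : ∀ l, 1 ≤ l → Summable fun i => ψ (l + i) := fun l hl =>
    Summable.of_nonneg_of_le (fun i => (hψ.1 _ (by omega)).le)
      (fun i => le_mul_of_one_le_left (hψ.1 _ (by omega)).le
        (by linarith [Nat.cast_nonneg (α := ℝ) i])) (hψ.summable_succ_mul hq hl)
  have hbound : ∀ j x, |harmonic f (j + 1) x| ≤ 2 * D * ψ (1 + j) := by
    intro j x
    have hpos := hψ.1 (j + 1) (by omega)
    rw [hφ.harmonic_eq (by omega) hpos, abs_mul, abs_of_pos hpos, mul_comm, add_comm 1 j]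
    gcongr
    obtain ⟨hA, hB⟩ := abs_coef_le hφi (j + 1)
    refine (abs_add_le _ _).trans ?_
    rw [abs_mul, abs_mul, two_mul]
    gcongr
    · exact (mul_le_of_le_one_right (abs_nonneg _) (abs_cos_le_one _)).trans hA
    · exact (mul_le_of_le_one_right (abs_nonneg _) (abs_sin_le_one _)).trans hB
  have hus : Summable fun j => 2 * D * ψ (1 + j) := (hψs 1 le_rfl).mul_left _
  have hterm : ∀ i x, weight p i * harmonic f (M + i) x = 1 / π * ∫ t, (φ t - T t) *
      (weight p i * ψ (M + i) * cos ((M + i : ℕ) * (x - t) - γ)) ∂periodMeasure := by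
    intro i x
    have e : ∀ t, (φ t - T t) * (weight p i * ψ (M + i) * cos ((M + i : ℕ) * (x - t) - γ)) =
        weight p i * ψ (M + i) *
          ((φ t - T t) * cos ((M + i : ℕ) * t + -((M + i : ℕ) * x - γ))) := by
      intro t
      rw [← cos_neg, show -((M + i : ℕ) * (x - t) - γ) = (M + i : ℕ) * t + -((M + i : ℕ) * x - γ)
        by ring]
      ring
    simp only [e, sub_mul]
    rw [integral_const_mul,
      integral_sub (integrable_mul_cos hφi _ _) (integrable_mul_cos hTi _ _),
      integral_trigPoly_mul_cos hT (by omega) (by omega), integral_mul_cos hφi,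
      hφ.harmonic_eq (by omega) (hψ.1 _ (by omega)), cos_neg, sin_neg, ← hγ]
    field_simp
    ring
  filter_upwards [ae_eq_tsum_harmonic hf.2 hus hbound] with x hx
  have hsx : Summable fun j => harmonic f (j + 1) x :=
    Summable.of_norm_bounded hus fun j => hbound j x
  have htail : ∀ k, HasSum (fun i => harmonic f (i + k + 1) x) (f x - fourierSum k f x) := by
    intro k
    have := (hasSum_nat_add_iff' k).2 hsx.hasSum
    convert! this using 1
    rw [hx, fourierSum_eq]; ring
  have hW := hasSum_weight_mul (d := fun i => harmonic f (M + i) x)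
    (t := fun l => f x - fourierSum (n - p + l) f x) (fun l => by
      convert! htail (n - p + l) using 3 with i
      omega) p
  have hV : f x - valleePoussinSum n p f x =
      1 / p * ∑ l ∈ Finset.range p, (f x - fourierSum (n - p + l) f x) := by
    rw [valleePoussinSum, Finset.sum_Ico_eq_sum_range, show n - (n - p) = p by omega,
      Finset.sum_sub_distrib, Finset.sum_const, Finset.card_range, nsmul_eq_mul]
    have : (p : ℝ) ≠ 0 := by positivity
    field_simp
  -- What remains is to exchange the sum over i with the integral against φ - T.
  rw [hV, ← hW.tsum_eq]
  simp only [smul_eq_mul, hterm]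
  rw [tsum_mul_left, ← mul_assoc, one_div_mul_one_div, mul_comm (p : ℝ)]
  congr 1
  have hsw := hasSum_integral_of_summable_integral_norm (μ := periodMeasure)
    (F := fun i t => (φ t - T t) *
      (weight p i * ψ (M + i) * cos ((M + i : ℕ) * (x - t) - γ)))
    (fun i => integrable_mul_of_bound (hφi.sub hTi) (by fun_prop)
      fun t => hψ.abs_kernel_term_le γ hM1 p i _)
    (by
      refine Summable.of_nonneg_of_le (fun i => integral_nonneg fun t => norm_nonneg _)
        (fun i => ?_) ((hψ.summable_succ_mul hq hM1).mul_left (∫ t, |φ t - T t| ∂periodMeasure))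
      rw [← integral_mul_const]
      refine integral_mono (integrable_mul_of_bound (hφi.sub hTi) (by fun_prop)
        fun t => hψ.abs_kernel_term_le γ hM1 p i _).norm
        ((hφi.sub hTi).norm.mul_const _) fun t => ?_
      simp only [norm_mul (φ t - T t)]
      exact mul_le_mul_of_nonneg_left (hψ.abs_kernel_term_le γ hM1 p i _) (norm_nonneg _))
  rw [hsw.tsum_eq]
  congr 1; ext t
  rw [tsum_mul_left, kernel]

/-! ### The generating function and its modulus of continuity -/

/-- The point `q e^{iu}`. -/
noncomputable def circlePt (q u : ℝ) : ℂ := q * Complex.exp (u * Complex.I)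

/-- The generating function `∑ min (i + 1, p) w ^ i` at `w = q e^{iu}`. -/
noncomputable def modulus (q : ℝ) (p : ℕ) (u : ℝ) : ℂ :=
  (1 - circlePt q u ^ p) / (1 - circlePt q u) ^ 2

lemma norm_circlePt {q : ℝ} (hq : 0 < q) (u : ℝ) : ‖circlePt q u‖ = q := by
  rw [circlePt, norm_mul, Complex.norm_exp_ofReal_mul_I, mul_one, Complex.norm_real,
    Real.norm_of_nonneg hq.le]

lemma circlePt_pow (q u : ℝ) (k : ℕ) :
    circlePt q u ^ k = ((q ^ k : ℝ) : ℂ) * Complex.exp ((k * u : ℝ) * Complex.I) := by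
  rw [circlePt, mul_pow, ← Complex.exp_nat_mul]
  push_cast
  congr 2; ring

lemma one_sub_circlePt_ne_zero {q : ℝ} (hq : 0 < q) (hq1 : q < 1) (u : ℝ) :
    1 - circlePt q u ≠ 0 := by
  intro h
  have := norm_circlePt hq u
  rw [← sub_eq_zero.1 h, norm_one] at this
  linarith

lemma norm_one_sub_sq (r x : ℝ) :
    ‖1 - (r : ℂ) * Complex.exp (x * Complex.I)‖ ^ 2 = 1 - 2 * r * cos x + r ^ 2 := by
  rw [← Complex.normSq_eq_norm_sq, Complex.normSq_apply]
  simp only [Complex.sub_re, Complex.one_re, Complex.sub_im, Complex.one_im, Complex.re_ofReal_mul,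
    Complex.im_ofReal_mul, Complex.exp_ofReal_mul_I_re, Complex.exp_ofReal_mul_I_im]
  nlinarith [sin_sq_add_cos_sq x]

/-- This identifies the modulus of the generating function with the function whose norm defines
`constK`. -/
lemma norm_modulus (q : ℝ) (p : ℕ) (u : ℝ) : ‖modulus q p u‖ =
    √(1 - 2 * q ^ p * cos (p * u) + q ^ (2 * p)) / (1 - 2 * q * cos u + q ^ 2) := by
  rw [modulus, norm_div, norm_pow, circlePt_pow, circlePt, norm_one_sub_sq, mul_comm 2 p, pow_mul,
    ← norm_one_sub_sq (q ^ p) (p * u), sqrt_sq (norm_nonneg _)]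

lemma continuous_circlePt (q : ℝ) : Continuous (circlePt q) := by
  unfold circlePt; fun_prop

lemma continuous_modulus {q : ℝ} (hq : 0 < q) (hq1 : q < 1) (p : ℕ) :
    Continuous (modulus q p) := by
  have := continuous_circlePt q
  unfold modulus
  exact Continuous.div (by fun_prop) (by fun_prop)
    fun u => pow_ne_zero _ (one_sub_circlePt_ne_zero hq hq1 u)

lemma circlePt_periodic (q : ℝ) : Function.Periodic (circlePt q) (2 * π) := by
  intro u
  unfold circlePt
  congr 1
  rw [Complex.exp_eq_exp_iff_exists_int]
  exact ⟨1, by push_cast; ring⟩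

lemma modulus_periodic (q : ℝ) (p : ℕ) : Function.Periodic (modulus q p) (2 * π) := fun u => by
  simp only [modulus, circlePt_periodic q u]

/-- The weighted series is the sum of the geometric tails w^l / (1 - w) over l < p, and these again
form a geometric sum. -/
lemma hasSum_modulus {q : ℝ} (hq : 0 < q) (hq1 : q < 1) (p : ℕ) (u : ℝ) :
    HasSum (fun i => (weight p i : ℂ) * circlePt q u ^ i) (modulus q p u) := by
  have hw : ‖circlePt q u‖ < 1 := by rwa [norm_circlePt hq]
  have hne := one_sub_circlePt_ne_zero hq hq1 u
  have h := hasSum_weight_mul (d := fun i => circlePt q u ^ i)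
    (t := fun l => (1 - circlePt q u)⁻¹ * circlePt q u ^ l) (fun l => by
      simpa only [pow_add] using (hasSum_geometric_of_norm_lt_one hw).mul_right
        (circlePt q u ^ l)) p
  rw [← Finset.mul_sum] at h
  convert! h using 1
  rw [modulus, ← mul_neg_geom_sum]
  field_simp

lemma hasSum_mul_pow {r : ℝ} (hr : 0 ≤ r) (hr1 : r < 1) :
    HasSum (fun i : ℕ => i * r ^ i) (r / (1 - r) ^ 2) :=
  hasSum_coe_mul_geometric_of_norm_lt_one (by rwa [Real.norm_of_nonneg hr])

lemma hasSum_succ_mul_mul_pow {r : ℝ} (hr : 0 ≤ r) (hr1 : r < 1) :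
    HasSum (fun i : ℕ => ((i : ℝ) + 1) * (i * r ^ i)) (2 * r / (1 - r) ^ 3) := by
  have h := (hasSum_choose_mul_geometric_of_norm_lt_one 2
    (by rwa [Real.norm_of_nonneg hr] : ‖r‖ < 1)).mul_left (2 * r)
  rw [← hasSum_nat_add_iff' 1]
  convert! h using 1
  · ext i
    rw [Nat.cast_choose_two]
    push_cast
    ring
  · simp; ring

lemma summable_weight_mul {r : ℝ} (hr : 0 ≤ r) (hr1 : r < 1) (p : ℕ) :
    Summable fun i : ℕ => weight p i * (i * r ^ i) :=
  Summable.of_nonneg_of_le (fun i => mul_nonneg (weight_nonneg _ _) (by positivity))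
    (fun i => mul_le_mul_of_nonneg_right (weight_le_succ p i) (by positivity))
    (hasSum_succ_mul_mul_pow hr hr1).summable

/-- Here the weight is bounded by i + 1, in the next lemma by p. The two bounds together produce
min{p, 1/(1-q)} in the remainder, and the exponents 3 and 2 in σ. -/
lemma tsum_weight_mul_le {r : ℝ} (hr : 0 ≤ r) (hr1 : r < 1) (p : ℕ) :
    ∑' i : ℕ, weight p i * (i * r ^ i) ≤ 2 * r / (1 - r) ^ 3 := by
  rw [← (hasSum_succ_mul_mul_pow hr hr1).tsum_eq]
  exact (summable_weight_mul hr hr1 p).tsum_le_tsum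
    (fun i => mul_le_mul_of_nonneg_right (weight_le_succ p i) (by positivity))
    (hasSum_succ_mul_mul_pow hr hr1).summable

lemma tsum_weight_mul_le' {r : ℝ} (hr : 0 ≤ r) (hr1 : r < 1) (p : ℕ) :
    ∑' i : ℕ, weight p i * (i * r ^ i) ≤ p * (r / (1 - r) ^ 2) := by
  rw [← ((hasSum_mul_pow hr hr1).mul_left (p : ℝ)).tsum_eq]
  exact (summable_weight_mul hr hr1 p).tsum_le_tsum
    (fun i => mul_le_mul_of_nonneg_right (weight_le p i) (by positivity))
    ((hasSum_mul_pow hr hr1).mul_left (p : ℝ)).summable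

lemma norm_circlePt_pow_sub_le {q : ℝ} (hq : 0 < q) (u v : ℝ) (i : ℕ) :
    ‖circlePt q (u + v) ^ i - circlePt q u ^ i‖ ≤ i * q ^ i * |v| := by
  have e : circlePt q (u + v) ^ i - circlePt q u ^ i =
      circlePt q u ^ i * (Complex.exp (Complex.I * ((i * v : ℝ) : ℂ)) - 1) := by
    rw [circlePt_pow, circlePt_pow, mul_sub, mul_one, mul_assoc, ← Complex.exp_add]
    congr 3
    push_cast; ring
  rw [e, norm_mul, norm_pow, norm_circlePt hq]
  have := Real.norm_exp_I_mul_ofReal_sub_one_le (x := i * v)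
  rw [Real.norm_eq_abs, abs_mul, Nat.abs_cast] at this
  calc _ ≤ q ^ i * (i * |v|) := by gcongr
    _ = _ := by ring

lemma norm_modulus_sub_le {q : ℝ} (hq : 0 < q) (hq1 : q < 1) (p : ℕ) (u v : ℝ) :
    ‖modulus q p (u + v) - modulus q p u‖ ≤ |v| * ∑' i : ℕ, weight p i * (i * q ^ i) := by
  have h := (hasSum_modulus hq hq1 p (u + v)).sub (hasSum_modulus hq hq1 p u)
  rw [← h.tsum_eq]
  refine tsum_of_norm_bounded (((summable_weight_mul hq.le hq1 p).hasSum).mul_left |v|)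
    fun i => ?_
  rw [← mul_sub, norm_mul, Complex.norm_real, Real.norm_of_nonneg (weight_nonneg _ _)]
  calc _ ≤ weight p i * (i * q ^ i * |v|) :=
        mul_le_mul_of_nonneg_left (norm_circlePt_pow_sub_le hq u v i) (weight_nonneg _ _)
    _ = _ := by ring

/-- The Poisson integral of a constant. -/
lemma integral_inv_norm_sq {q : ℝ} (hq : 0 < q) (hq1 : q < 1) :
    ∫ u, (‖1 - circlePt q u‖ ^ 2)⁻¹ ∂periodMeasure = 2 * π / (1 - q ^ 2) := by
  -- Poisson's formula for the constant 1 on the unit circle at the point q, using |e^{iθ} - q| = |1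
  -- - q e^{iθ}|.
  have h := DiffContOnCl.circleAverage_poissonKernel_smul' (E := ℂ) (f := fun _ => (1 : ℂ))
    (c := 0) (R := 1) (w := (q : ℂ)) diffContOnCl_const
    (by simp [abs_of_pos hq, hq1])
  rw [circleAverage_def] at h
  have hpt : ∀ θ : ℝ, ((‖circleMap 0 1 θ - 0‖ ^ 2 - ‖(q : ℂ) - 0‖ ^ 2) /
      ‖(circleMap 0 1 θ - 0) - ((q : ℂ) - 0)‖ ^ 2) • (1 : ℂ) =
        (((1 - q ^ 2) * (‖1 - circlePt q θ‖ ^ 2)⁻¹ : ℝ) : ℂ) := by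
    intro θ
    have e : ‖(circleMap 0 1 θ - 0) - ((q : ℂ) - 0)‖ ^ 2 = ‖1 - circlePt q θ‖ ^ 2 := by
      rw [circlePt, norm_one_sub_sq, ← Complex.normSq_eq_norm_sq, Complex.normSq_apply]
      simp [circleMap, Complex.exp_re, Complex.exp_im]
      nlinarith [sin_sq_add_cos_sq θ]
    rw [e]
    simp [circleMap, abs_of_pos hq, div_eq_mul_inv]
  simp only [hpt] at h
  rw [intervalIntegral.integral_ofReal, intervalIntegral.integral_const_mul] at h
  have hper : Function.Periodic (fun u => (‖1 - circlePt q u‖ ^ 2)⁻¹) (2 * π) := fun u => by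
    simp only [circlePt_periodic q u]
  have hsh := hper.intervalIntegral_add_eq (-π) 0
  rw [show -π + 2 * π = π by ring, zero_add, intervalIntegral_eq_period] at hsh
  rw [← hsh] at h
  set J := ∫ u, (‖1 - circlePt q u‖ ^ 2)⁻¹ ∂periodMeasure
  have h' : (2 * π)⁻¹ * ((1 - q ^ 2) * J) = 1 := by
    rw [Complex.real_smul] at h
    exact_mod_cast h
  have hq2 : 1 - q ^ 2 ≠ 0 := by nlinarith
  rw [eq_div_iff hq2]
  field_simp at h'
  linarith

/-- For p = 1 the generating function is 1/(1 - w), so the difference factors; ab ≤ (a² + b²)/2 then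
leaves Poisson kernels. Their integral is of order 1/(1-q), one power better than the uniform bound,
whence σ = 1 for s = p = 1. -/
lemma norm_modulus_one_sub_le {q : ℝ} (hq : 0 < q) (hq1 : q < 1) (u v : ℝ) :
    ‖modulus q 1 (u + v) - modulus q 1 u‖ ≤
      q * |v| / 2 * ((‖1 - circlePt q (u + v)‖ ^ 2)⁻¹ + (‖1 - circlePt q u‖ ^ 2)⁻¹) := by
  have h1 := one_sub_circlePt_ne_zero hq hq1 u
  have h2 := one_sub_circlePt_ne_zero hq hq1 (u + v)
  have e : modulus q 1 (u + v) - modulus q 1 u = (circlePt q (u + v) - circlePt q u) *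
      ((1 - circlePt q (u + v))⁻¹ * (1 - circlePt q u)⁻¹) := by
    unfold modulus
    field_simp
    ring
  have h3 := norm_circlePt_pow_sub_le hq u v 1
  simp only [pow_one, Nat.cast_one, one_mul] at h3
  rw [e, norm_mul, norm_mul, norm_inv, norm_inv, ← inv_pow, ← inv_pow]
  set a := ‖1 - circlePt q (u + v)‖⁻¹
  set b := ‖1 - circlePt q u‖⁻¹
  have ha : 0 ≤ a := by positivity
  have hb : 0 ≤ b := by positivity
  calc _ ≤ q * |v| * (a * b) := by gcongr
    _ ≤ q * |v| * ((a ^ 2 + b ^ 2) / 2) := by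
      gcongr
      nlinarith [sq_nonneg (a - b)]
    _ = _ := by ring

lemma normL_modulus_one_sub_le {q : ℝ} (hq : 0 < q) (hq1 : q < 1) (v : ℝ) :
    normL 1 (fun u => ‖modulus q 1 (u + v) - modulus q 1 u‖) ≤
      ENNReal.ofReal (q * |v| * (2 * π / (1 - q ^ 2))) := by
  set P : ℝ → ℝ := fun u => (‖1 - circlePt q u‖ ^ 2)⁻¹ with hP
  have hPc : Continuous P := by
    have := continuous_circlePt q
    exact Continuous.inv₀ (by fun_prop)
      fun u => pow_ne_zero _ (norm_ne_zero_iff.2 (one_sub_circlePt_ne_zero hq hq1 u))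
  have hPp : Function.Periodic P (2 * π) := fun u => by
    simp only [hP, circlePt_periodic q u]
  have hP0 : ∀ u, 0 ≤ P u := fun u => by positivity
  have hP1 : normL 1 P = ENNReal.ofReal (2 * π / (1 - q ^ 2)) := by
    rw [normL, eLpNorm_one_eq_lintegral_enorm, ← integral_inv_norm_sq hq hq1,
      ofReal_integral_eq_lintegral_ofReal (integrable_period_of_continuous hPc)
        (ae_of_all _ hP0)]
    congr 1; ext u
    rw [Real.enorm_of_nonneg (hP0 u)]
  calc normL 1 (fun u => ‖modulus q 1 (u + v) - modulus q 1 u‖)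
      ≤ normL 1 ((q * |v| / 2) • fun u => P (u + v) + P u) := by
        refine normL_mono fun u => ?_
        rw [abs_of_nonneg (norm_nonneg _)]
        exact (norm_modulus_one_sub_le hq hq1 u v).trans (le_abs_self _)
    _ = ENNReal.ofReal (q * |v| / 2) * normL 1 (fun u => P (u + v) + P u) := by
        rw [normL, eLpNorm_const_smul, Real.enorm_of_nonneg (by positivity)]; rfl
    _ ≤ ENNReal.ofReal (q * |v| / 2) * (normL 1 P + normL 1 P) := by
        gcongr
        refine (normL_add_le (f := fun u => P (u + v)) le_rfl (by fun_prop) hPc).trans_eq ?_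
        rw [normL_comp_add le_rfl ENNReal.one_ne_top hPp]
    _ = _ := by
        have : 0 ≤ 2 * π / (1 - q ^ 2) := div_nonneg (by positivity) (by nlinarith)
        rw [hP1, ← ENNReal.ofReal_add this this, ← ENNReal.ofReal_mul (by positivity)]
        congr 1; ring

lemma normL_modulus_sub_le {q : ℝ} (hq : 0 < q) (hq1 : q < 1) {p : ℕ} (hp : 1 ≤ p) {s : ℝ≥0∞}
    (hs : 1 ≤ s) (v : ℝ) :
    normL s (fun u => ‖modulus q p (u + v) - modulus q p u‖) ≤
      ENNReal.ofReal (4 * π * |v| * (q / (1 - q) ^ sigma s p)) := by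
  have h1q : 0 < 1 - q := by linarith
  have hsup : normL s (fun u => ‖modulus q p (u + v) - modulus q p u‖) ≤
      ENNReal.ofReal (2 * π * (|v| * ∑' i : ℕ, weight p i * (i * q ^ i))) :=
    normL_le_of_bound hs fun u => by
      rw [abs_of_nonneg (norm_nonneg _)]; exact norm_modulus_sub_le hq hq1 p u v
  unfold sigma
  split_ifs with h1 h2
  · subst h1 h2
    refine (normL_modulus_one_sub_le hq hq1 v).trans (ENNReal.ofReal_le_ofReal ?_)
    rw [pow_one]
    have : 1 / (1 - q ^ 2) ≤ 1 / (1 - q) :=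
      one_div_le_one_div_of_le h1q (by nlinarith)
    calc q * |v| * (2 * π / (1 - q ^ 2)) = 2 * π * |v| * q * (1 / (1 - q ^ 2)) := by ring
      _ ≤ 2 * π * |v| * q * (1 / (1 - q)) := by gcongr
      _ ≤ 4 * π * |v| * q * (1 / (1 - q)) := by gcongr; norm_num
      _ = _ := by ring
  · refine hsup.trans (ENNReal.ofReal_le_ofReal ?_)
    have := tsum_weight_mul_le' hq.le hq1 p
    rw [h1, Nat.cast_one, one_mul] at this
    rw [h1]
    calc _ ≤ 2 * π * (|v| * (q / (1 - q) ^ 2)) := by gcongr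
      _ ≤ 4 * π * (|v| * (q / (1 - q) ^ 2)) := by gcongr; norm_num
      _ = _ := by ring
  · refine hsup.trans (ENNReal.ofReal_le_ofReal ?_)
    have := tsum_weight_mul_le hq.le hq1 p
    calc _ ≤ 2 * π * (|v| * (2 * q / (1 - q) ^ 3)) := by gcongr
      _ = _ := by ring

/-! ### The norm of the kernel -/

lemma one_le_normL_top_cos : 1 ≤ normL ⊤ cos := by
  have := enorm_le_normL_top continuous_cos cos_periodic 0
  simpa using this

/-- The leading part of the kernel. -/
lemma normL_leading_le {q : ℝ} (hq : 0 < q) (hq1 : q < 1) {p : ℕ} (hp : 1 ≤ p) {s : ℝ≥0∞}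
    (hs : 1 ≤ s) {M : ℕ} (hM : 0 < M) (γ : ℝ) :
    normL s (fun u => (Complex.exp ((M * u - γ : ℝ) * Complex.I) * modulus q p u).re) ≤
      ENNReal.ofReal (π * mainTerm q p s + 4 * π ^ 2 * (q / (M * (1 - q) ^ sigma s p))) := by
  have hGc := continuous_modulus hq hq1 p
  have hGp := modulus_periodic q p
  have hNp : Function.Periodic (fun u => ‖modulus q p u‖) (2 * π) := fun u => by
    simp only [hGp u]
  have hN := normL_ne_top_of_continuous hs hGc.norm hNp
  have hC := normL_ne_top_of_continuous hs continuous_cos cos_periodic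
  have h1q : 0 < 1 - q := by linarith
  have hmain : π * mainTerm q p s = (2 * π) ^ (-(s⁻¹).toReal) * (normL s cos).toReal *
      (normL s fun u => ‖modulus q p u‖).toReal := by
    rw [mainTerm, constK]
    simp only [← norm_modulus]
    rw [rpow_add pi_pos, rpow_one, mul_rpow two_pos.le pi_pos.le, rpow_neg pi_pos.le]
    field_simp
  have hmain0 : 0 ≤ π * mainTerm q p s := by rw [hmain]; positivity
  have herr : 0 ≤ 4 * π ^ 2 * (q / (M * (1 - q) ^ sigma s p)) := by positivity
  rw [ENNReal.ofReal_add hmain0 herr, hmain, ENNReal.ofReal_mul (by positivity),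
    ENNReal.ofReal_mul (by positivity), ENNReal.ofReal_toReal hC, ENNReal.ofReal_toReal hN]
  -- For s = ∞ no averaging is needed: |Re(e^{i·} G)| ≤ |G| and the norm of the cosine is at least
  -- 1.
  rcases eq_or_ne s ⊤ with rfl | hs'
  · refine le_add_right ?_
    simp only [ENNReal.inv_top, ENNReal.toReal_zero, neg_zero, rpow_zero, ENNReal.ofReal_one,
      one_mul]
    calc _ ≤ normL ⊤ (fun u => ‖modulus q p u‖) := normL_mono fun u => by
            rw [abs_of_nonneg (norm_nonneg _)]
            refine (Complex.abs_re_le_norm _).trans ?_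
            rw [norm_mul, Complex.norm_exp_ofReal_mul_I, one_mul]
      _ ≤ _ := le_mul_of_one_le_left zero_le one_le_normL_top_cos
  · refine normL_modulated_le hs hs' hGc hGp hM γ fun v hv => ?_
    refine (normL_modulus_sub_le hq hq1 hp hs v).trans (ENNReal.ofReal_le_ofReal ?_)
    calc _ ≤ 4 * π * (π / M) * (q / (1 - q) ^ sigma s p) := by gcongr
      _ = _ := by field_simp

lemma hasSum_leading {q : ℝ} (hq : 0 < q) (hq1 : q < 1) (p M : ℕ) (γ u : ℝ) :
    HasSum (fun i : ℕ => weight p i * q ^ i * cos ((M + i : ℕ) * u - γ))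
      (Complex.exp ((M * u - γ : ℝ) * Complex.I) * modulus q p u).re := by
  have h := Complex.hasSum_re
    ((hasSum_modulus hq hq1 p u).mul_left (Complex.exp ((M * u - γ : ℝ) * Complex.I)))
  convert! h using 2 with i
  rw [circlePt_pow, mul_left_comm, mul_left_comm (Complex.exp _), ← Complex.exp_add, ← mul_assoc,
    ← Complex.ofReal_mul, Complex.re_ofReal_mul, ← add_mul, ← Complex.ofReal_add,
    Complex.exp_ofReal_mul_I_re]
  congr 2
  push_cast; ring

lemma ClassD.abs_sub_le_eps {q : ℝ} {ψ : ℕ → ℝ} (hψ : ClassD q ψ) (M j : ℕ) :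
    |ψ (M + j + 1) / ψ (M + j) - q| ≤ eps q ψ M := by
  -- A real supremum dominates its terms only if the family is bounded above; convergence supplies
  -- this.
  have h : Tendsto (fun j : ℕ => |ψ (M + j + 1) / ψ (M + j) - q|) atTop (𝓝 |q - q|) := by
    have := (tendsto_add_atTop_iff_nat M).2 hψ.2
    simp only [add_comm _ M] at this
    exact (this.sub_const q).abs
  exact le_ciSup h.bddAbove_range j

lemma eps_nonneg (q : ℝ) (ψ : ℕ → ℝ) (M : ℕ) : 0 ≤ eps q ψ M :=
  Real.iSup_nonneg fun _ => abs_nonneg _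

/-- Induction on i, splitting x r - q^(i+1) as (x - q) r + q (r - q^i). The factor ρ on the left
stands for the expected bound ε i ρ^(i-1) and avoids the exponent i - 1. -/
lemma ClassD.ratio_bounds {q : ℝ} {ψ : ℕ → ℝ} (hψ : ClassD q ψ) (hq : 0 < q) {M : ℕ}
    (hM : 1 ≤ M) {ρ : ℝ} (hρ : q + eps q ψ M ≤ ρ) (i : ℕ) :
    ψ (M + i) / ψ M ≤ ρ ^ i ∧
      |ψ (M + i) / ψ M - q ^ i| * ρ ≤ eps q ψ M * (i * ρ ^ i) := by
  have he := eps_nonneg q ψ M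
  have hρ0 : 0 < ρ := by linarith
  have hpos : ∀ i, 0 < ψ (M + i) := fun i => hψ.1 _ (by omega)
  have hM0 : 0 < ψ M := hpos 0
  induction i with
  | zero => simp [div_self hM0.ne']
  | succ i ih =>
    obtain ⟨ih1, ih2⟩ := ih
    have hx := hψ.abs_sub_le_eps M i
    have e : ψ (M + (i + 1)) / ψ M = ψ (M + i + 1) / ψ (M + i) * (ψ (M + i) / ψ M) := by
      have := (hpos i).ne'
      rw [← add_assoc]; field_simp
    have hr0 : 0 ≤ ψ (M + i) / ψ M := (div_pos (hpos i) hM0).le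
    set x := ψ (M + i + 1) / ψ (M + i) with hxdef
    set r := ψ (M + i) / ψ M with hr
    have hx0 : 0 ≤ x := (div_pos (hpos (i + 1)) (hpos i)).le
    have hxρ : x ≤ ρ := by linarith [(abs_le.1 hx).2]
    rw [e]
    constructor
    · rw [pow_succ, mul_comm]
      exact mul_le_mul ih1 hxρ hx0 (by positivity)
    · have e2 : x * r - q ^ (i + 1) = (x - q) * r + q * (r - q ^ i) := by ring
      calc |x * r - q ^ (i + 1)| * ρ ≤ (|x - q| * r + q * |r - q ^ i|) * ρ := by
            gcongr
            rw [e2]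
            refine (abs_add_le _ _).trans_eq ?_
            rw [abs_mul, abs_mul, abs_of_nonneg hr0, abs_of_pos hq]
        _ = |x - q| * r * ρ + q * (|r - q ^ i| * ρ) := by ring
        _ ≤ eps q ψ M * ρ ^ i * ρ + ρ * (eps q ψ M * (i * ρ ^ i)) := by
            gcongr
            linarith
        _ = _ := by push_cast; ring

/-- The kernel differs little from its leading part. -/
lemma ClassD.abs_kernel_sub_le {q : ℝ} {ψ : ℕ → ℝ} (hψ : ClassD q ψ) (hq : 0 < q) (hq1 : q < 1)
    (γ : ℝ) {M : ℕ} (hM : 1 ≤ M) (p : ℕ) (hε : eps q ψ M ≤ (1 - q) / 2) (u : ℝ) :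
    |kernel ψ γ M p u -
        ψ M * (Complex.exp ((M * u - γ : ℝ) * Complex.I) * modulus q p u).re| ≤
      ψ M * (16 * (eps q ψ M / (1 - q) ^ 2 * min (p : ℝ) (1 / (1 - q)))) := by
  have hM0 : 0 < ψ M := hψ.1 _ hM
  have he := eps_nonneg q ψ M
  have h1q : 0 < 1 - q := by linarith
  -- The midpoint of q and 1: the hypothesis on ε gives q + ε ≤ ρ, while 1 - ρ = (1 - q)/2 keeps the
  -- loss to an absolute constant.
  set ρ := (1 + q) / 2 with hρ
  have hρ0 : 0 < ρ := by rw [hρ]; linarith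
  have hρ1 : ρ < 1 := by rw [hρ]; linarith
  have hρq : 1 - ρ = (1 - q) / 2 := by rw [hρ]; ring
  have hk : HasSum (fun i => weight p i * ψ (M + i) * cos ((M + i : ℕ) * u - γ))
      (kernel ψ γ M p u) :=
    (Summable.of_norm_bounded (hψ.summable_succ_mul hq1 hM)
      fun i => hψ.abs_kernel_term_le γ hM p i u).hasSum
  have hd := hk.sub ((hasSum_leading hq hq1 p M γ u).mul_left (ψ M))
  have hb := tsum_of_norm_bounded ((summable_weight_mul hρ0.le hρ1 p).hasSum.mul_left
    (ψ M * eps q ψ M / ρ)) (f := fun i => weight p i * ψ (M + i) * cos ((M + i : ℕ) * u - γ) -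
      ψ M * (weight p i * q ^ i * cos ((M + i : ℕ) * u - γ))) (fun i => by
    have h := (hψ.ratio_bounds hq hM (ρ := ρ) (by rw [hρ]; linarith) i).2
    have e : weight p i * ψ (M + i) * cos ((M + i : ℕ) * u - γ) -
        ψ M * (weight p i * q ^ i * cos ((M + i : ℕ) * u - γ)) =
        ψ M * weight p i * (ψ (M + i) / ψ M - q ^ i) * cos ((M + i : ℕ) * u - γ) := by
      field_simp
    rw [e, norm_mul, norm_mul, Real.norm_of_nonneg (mul_nonneg hM0.le (weight_nonneg _ _))]
    have h0 := mul_nonneg hM0.le (weight_nonneg p i)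
    calc _ ≤ ψ M * weight p i * |ψ (M + i) / ψ M - q ^ i| * 1 :=
          mul_le_mul_of_nonneg_left (abs_cos_le_one _) (mul_nonneg h0 (abs_nonneg _))
      _ ≤ ψ M * weight p i * (eps q ψ M * (i * ρ ^ i) / ρ) := by
          rw [mul_one]
          exact mul_le_mul_of_nonneg_left ((le_div_iff₀ hρ0).2 h) h0
      _ = _ := by ring)
  rw [hd.tsum_eq] at hb
  refine hb.trans ?_
  -- Both bounds for the sum contain a factor ρ, which cancels the division. Halving 1 - q costs 4
  -- in the bound with p and, with the 2 already there, 16 in the other.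
  have hW : (∑' i : ℕ, weight p i * (i * ρ ^ i)) / ρ ≤
      16 * (1 / (1 - q) ^ 2 * min (p : ℝ) (1 / (1 - q))) := by
    rw [div_le_iff₀ hρ0]
    rcases min_choice (p : ℝ) (1 / (1 - q)) with h | h <;> rw [h]
    · refine (tsum_weight_mul_le' hρ0.le hρ1 p).trans ?_
      rw [hρq]
      have : (p : ℝ) * (ρ / ((1 - q) / 2) ^ 2) = 4 * (1 / (1 - q) ^ 2 * p) * ρ := by
        field_simp; norm_num
      rw [this]
      gcongr; norm_num
    · refine (tsum_weight_mul_le hρ0.le hρ1 p).trans_eq ?_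
      rw [hρq]
      field_simp; norm_num
  calc _ = ψ M * eps q ψ M * ((∑' i : ℕ, weight p i * (i * ρ ^ i)) / ρ) := by ring
    _ ≤ ψ M * eps q ψ M * (16 * (1 / (1 - q) ^ 2 * min (p : ℝ) (1 / (1 - q)))) := by gcongr
    _ = _ := by ring

lemma mainTerm_nonneg (q : ℝ) (p : ℕ) (s : ℝ≥0∞) : 0 ≤ mainTerm q p s := by
  unfold mainTerm constK; positivity

lemma ClassD.normL_kernel_le {q : ℝ} {ψ : ℕ → ℝ} (hψ : ClassD q ψ) (hq : 0 < q) (hq1 : q < 1)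
    (γ : ℝ) {n p : ℕ} (hp : 1 ≤ p) (hε : eps q ψ (n - p + 1) ≤ (1 - q) / 2) {s : ℝ≥0∞}
    (hs : 1 ≤ s) :
    normL s (kernel ψ γ (n - p + 1) p) ≤ ENNReal.ofReal (π * ψ (n - p + 1) *
      (mainTerm q p s + 32 * remainder q ψ n p s)) := by
  rw [remainder]
  set M := n - p + 1 with hMdef
  have hM : 1 ≤ M := by omega
  have hM0 : 0 < ψ M := hψ.1 _ hM
  have he := eps_nonneg q ψ M
  have h1q : 0 < 1 - q := by linarith
  have hGc := continuous_modulus hq hq1 p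
  have hKc := hψ.continuous_kernel hq1 γ hM p
  set L : ℝ → ℝ := fun u => (Complex.exp ((M * u - γ : ℝ) * Complex.I) * modulus q p u).re with hL
  have hLc : Continuous L := by simp only [hL]; fun_prop
  set R₁ := q / (M * (1 - q) ^ sigma s p) with hR₁
  set R₂ := eps q ψ M / (1 - q) ^ 2 * min (p : ℝ) (1 / (1 - q)) with hR₂
  have hR₁0 : 0 ≤ R₁ := by positivity
  have hR₂0 : 0 ≤ R₂ := by positivity
  have hm := mainTerm_nonneg q p s
  calc normL s (kernel ψ γ M p)
      = normL s (fun u => (ψ M • L) u + (kernel ψ γ M p u - ψ M * L u)) := by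
        congr 1; ext u; simp
    _ ≤ normL s (ψ M • L) + normL s (fun u => kernel ψ γ M p u - ψ M * L u) :=
        normL_add_le hs (hLc.const_smul _) (by fun_prop)
    _ ≤ ENNReal.ofReal (ψ M) * ENNReal.ofReal (π * mainTerm q p s + 4 * π ^ 2 * R₁) +
        ENNReal.ofReal (2 * π * (ψ M * (16 * R₂))) := by
        gcongr
        · rw [normL, eLpNorm_const_smul, Real.enorm_of_nonneg hM0.le]
          gcongr
          exact normL_leading_le hq hq1 hp hs hM γ
        · exact normL_le_of_bound hs fun u => hψ.abs_kernel_sub_le hq hq1 γ hM p hε u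
    _ ≤ _ := by
        rw [← ENNReal.ofReal_mul hM0.le, ← ENNReal.ofReal_add (by positivity) (by positivity)]
        apply ENNReal.ofReal_le_ofReal
        -- After extraction of π the two error terms have coefficients 4π and 2 · 16; hence the
        -- constant 32.
        have hπ : 4 * π ≤ 32 := by linarith [pi_lt_four]
        calc _ = π * ψ M * (mainTerm q p s + 4 * π * R₁ + 32 * R₂) := by ring
          _ ≤ π * ψ M * (mainTerm q p s + 32 * R₁ + 32 * R₂) := by gcongr
          _ = _ := by ring

lemma remainder_pos {q : ℝ} (hq : 0 < q) (hq1 : q < 1) (ψ : ℕ → ℝ) (n p : ℕ) (s : ℝ≥0∞) :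
    0 < remainder q ψ n p s := by
  have h1q : 0 < 1 - q := by linarith
  have he := eps_nonneg q ψ (n - p + 1)
  unfold remainder
  positivity

/-! ### From the kernel to the Lebesgue-type inequality -/

/-- A bound for the norm of the kernel gives the Lebesgue-type inequality. -/
lemma ClassD.lebesgueInequality_of_kernel {q : ℝ} {ψ : ℕ → ℝ} (hψ : ClassD q ψ) (hq : 0 < q)
    (hq1 : q < 1) {β : ℝ} {n p : ℕ} (hp : 1 ≤ p) (hpn : p ≤ n) {C : ℝ} (hC : 0 < C)
    (hK : ∀ s : ℝ≥0∞, 1 ≤ s → normL s (kernel ψ (β * π / 2) (n - p + 1) p) ≤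
      ENNReal.ofReal (π * ψ (n - p + 1) * (mainTerm q p s + C * remainder q ψ n p s))) :
    LebesgueInequality C q ψ β n p := by
  intro s hs f φ hf hφ
  have hM : 1 ≤ n - p + 1 := by omega
  have hM0 : 0 < ψ (n - p + 1) := hψ.1 _ hM
  have hp0 : (0 : ℝ) < p := by exact_mod_cast hp
  have hm := mainTerm_nonneg q p s
  have hr := remainder_pos hq hq1 ψ n p s
  have hpos : 0 < ψ (n - p + 1) / p * (mainTerm q p s + C * remainder q ψ n p s) := by positivity
  -- The infimum over T outside the class is ∞, so the factor must be nonzero to pass through it;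
  -- strict positivity of the remainder guarantees this.
  have hne : ENNReal.ofReal (ψ (n - p + 1) / p * (mainTerm q p s + C * remainder q ψ n p s)) ≠ 0 :=
    (ENNReal.ofReal_pos.2 hpos).ne'
  rw [bestApprox, ENNReal.mul_iInf_of_ne hne ENNReal.ofReal_ne_top]
  refine le_iInf fun T => ?_
  rw [ENNReal.mul_iInf_of_ne hne ENNReal.ofReal_ne_top]
  refine le_iInf fun hT => ?_
  have hTi : Integrable T periodMeasure :=
    integrable_period_of_continuous (continuous_of_mem_trigPoly hT)
  rw [normL, eLpNorm_congr_ae (sub_valleePoussinSum_ae_eq hψ hq1 hp hpn hf hφ hT)]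
  calc _ = ENNReal.ofReal (1 / (π * p)) * normL s (fun x => ∫ t, (φ t - T t) *
        kernel ψ (β * π / 2) (n - p + 1) p (x - t) ∂periodMeasure) := by
        rw [← Real.enorm_of_nonneg (by positivity : 0 ≤ 1 / (π * p)), normL, ← eLpNorm_const_smul]
        rfl
    _ ≤ ENNReal.ofReal (1 / (π * p)) * (normL 1 (fun t => φ t - T t) *
        normL s (kernel ψ (β * π / 2) (n - p + 1) p)) := by
        gcongr
        exact normL_convolution_le hs (hφ.1.2.sub hTi) (hψ.continuous_kernel hq1 _ hM p)
          (kernel_periodic _ _ _ _)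
    _ ≤ ENNReal.ofReal (1 / (π * p)) * (normL 1 (fun t => φ t - T t) *
        ENNReal.ofReal (π * ψ (n - p + 1) * (mainTerm q p s + C * remainder q ψ n p s))) := by
        gcongr
        exact hK s hs
    _ = _ := by
        rw [mul_left_comm, ← ENNReal.ofReal_mul (by positivity), mul_comm]
        congr 2
        field_simp

end ValleePoussin

theorem mainTheorem2 :
    ∃ C : ℝ, 0 < C ∧
      ∀ (q : ℝ), 0 < q → q < 1 → ∀ (ψ : ℕ → ℝ), ValleePoussin.ClassD q ψ →
        (∃ N : ℕ, ∀ (β : ℝ) (n p : ℕ), 1 ≤ p → p ≤ n → N ≤ n - p →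
          ValleePoussin.LebesgueInequality C q ψ β n p) ∧
        (∀ (β : ℝ) (n p : ℕ), 1 ≤ p → p ≤ n →
          ValleePoussin.eps q ψ (n - p + 1) ≤ (1 - q) / 2 →
          ValleePoussin.LebesgueInequality C q ψ β n p) ∧
        (∃ C' : ℝ, 0 < C' ∧ ∀ (β : ℝ) (n p : ℕ), 1 ≤ p → p ≤ n →
          ValleePoussin.LebesgueInequality C' q ψ β n p) := by
  open ValleePoussin in
  refine ⟨32, by norm_num, fun q hq hq1 ψ hψ => ?_⟩
  have h1q : 0 < 1 - q := by linarith
  obtain ⟨N, hN⟩ : ∃ N : ℕ, ∀ m, N ≤ m → eps q ψ (m + 1) ≤ (1 - q) / 2 := by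
    obtain ⟨N, hN⟩ := Metric.tendsto_atTop.1 hψ.2 ((1 - q) / 2) (by positivity)
    refine ⟨N, fun m hm => Real.iSup_le (fun j => ?_) (by positivity)⟩
    have := hN (m + 1 + j) (by omega)
    rw [Real.dist_eq] at this
    exact this.le
  have hsmall : ∀ (β : ℝ) (n p : ℕ), 1 ≤ p → p ≤ n → eps q ψ (n - p + 1) ≤ (1 - q) / 2 →
      LebesgueInequality 32 q ψ β n p := fun β n p hp hpn hε =>
    hψ.lebesgueInequality_of_kernel hq hq1 hp hpn (by norm_num)
      fun s hs => hψ.normL_kernel_le hq hq1 _ hp hε hs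
  refine ⟨⟨N, fun β n p hp hpn hNn => hsmall β n p hp hpn (hN _ hNn)⟩, hsmall, ?_⟩
  -- The crude kernel bound relative to ψ(M), with m = M - 1. It depends on n and p only through M,
  -- and not on β or s, so a finite sum over m < N covers all exceptional cases.
  let Z : ℕ → ℝ := fun m => |(∑' i : ℕ, ((i : ℝ) + 1) * ψ (m + 1 + i)) / ψ (m + 1)|
  have hZ0 : 0 ≤ ∑ m ∈ Finset.range N, 4 * Z m :=
    Finset.sum_nonneg fun m _ => mul_nonneg (by norm_num) (abs_nonneg _)
  refine ⟨32 + ∑ m ∈ Finset.range N, 4 * Z m, by positivity, fun β n p hp hpn => ?_⟩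
  refine hψ.lebesgueInequality_of_kernel hq hq1 hp hpn (by positivity) fun s hs => ?_
  have hM0 : 0 < ψ (n - p + 1) := hψ.1 _ (by omega)
  have hm := mainTerm_nonneg q p s
  have hr := remainder_pos hq hq1 ψ n p s
  by_cases hε : eps q ψ (n - p + 1) ≤ (1 - q) / 2
  · refine (hψ.normL_kernel_le hq hq1 _ hp hε hs).trans (ENNReal.ofReal_le_ofReal ?_)
    gcongr
    linarith
  · have hlt : n - p < N := by
      by_contra h
      exact hε (hN _ (not_lt.1 h))
    push Not at hε
    have hZ : 4 * Z (n - p) ≤ ∑ m ∈ Finset.range N, 4 * Z m :=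
      Finset.single_le_sum (f := fun m => 4 * Z m)
        (fun m _ => mul_nonneg (by norm_num) (abs_nonneg _)) (Finset.mem_range.2 hlt)
    -- From ε > (1-q)/2 one gets ε/(1-q)² ≥ 1/2. The coefficient 4 of Z compensates this 1/2 and the
    -- factor 2 left from the period length 2π.
    have hrem : 1 / 2 ≤ remainder q ψ n p s := by
      have hmin : 1 ≤ min (p : ℝ) (1 / (1 - q)) :=
        le_min (by exact_mod_cast hp) ((one_le_div h1q).2 (by linarith))
      have h2 : 1 / 2 ≤ eps q ψ (n - p + 1) / (1 - q) ^ 2 := by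
        rw [le_div_iff₀ (by positivity)]
        nlinarith
      have h3 : 1 / 2 * 1 ≤ eps q ψ (n - p + 1) / (1 - q) ^ 2 * min (p : ℝ) (1 / (1 - q)) :=
        mul_le_mul h2 hmin zero_le_one (by linarith)
      have h4 : 0 ≤ q / (((n - p + 1 : ℕ) : ℝ) * (1 - q) ^ sigma s p) := by positivity
      rw [remainder]
      linarith
    refine (normL_le_of_bound hs fun u => hψ.abs_kernel_le hq1 (β * π / 2) (by omega) p u).trans
      (ENNReal.ofReal_le_ofReal ?_)
    have hsum : ∑' i : ℕ, ((i : ℝ) + 1) * ψ (n - p + 1 + i) ≤ ψ (n - p + 1) * Z (n - p) := by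
      rw [← div_le_iff₀' hM0]
      exact le_abs_self _
    have hZn : 0 ≤ Z (n - p) := abs_nonneg _
    calc _ ≤ 2 * π * (ψ (n - p + 1) * Z (n - p)) := by gcongr
      _ = π * ψ (n - p + 1) * (0 + 4 * Z (n - p) * (1 / 2)) := by ring
      _ ≤ _ := by
        gcongr
        linarith
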